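/- There exists a planar 3-tree that has no planar Lombardi drawing. Here a \emph{planar 3-tree} (Apollonian network) is a graph that can be formed, starting from a triangle embedded in the plane, by repeatedly adding a new vertex within a triangular face (inner or outer) and connecting it to the three vertices of that face, which subdivides the face into three triangular faces. A \emph{Lombardi drawing} of a finite simple graph $G=(V,E)$ represents the vertices by distinct points of the plane and every edge by a line segment or a circular arc (a proper arc of a circle) between the points of its two endpoints that passes through no other vertex, such that every vertex $v$ has perfect angular resolution: the directions in which the edges at $v$ leave $v$, measured by the tangents to the arcs at $v$, are equally spaced, so that any two consecutive ones form the angle $2\pi/\deg(v)$. The drawing is \emph{planar} if the arcs of two distinct edges have no point in common except a common endpoint. -/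

import Mathlib

/-- `γ` is a (non-degenerate) line segment, parametrized affinely on `[0, 1]`. -/
def IsSegmentCurve (γ : ℝ → ℂ) : Prop :=
  ∃ p q : ℂ, p ≠ q ∧ ∀ t : ℝ, γ t = p + (t : ℂ) * (q - p)

/-- `γ` is a circular arc: on `[0, 1]` it runs with constant speed along the circle of centre `c`
and radius `r > 0`, from the point at angle `φ` to the point at angle `φ + θ`. The sweep `θ` is
non-zero and less than a full turn, in either direction. -/
def IsCircleArcCurve (γ : ℝ → ℂ) : Prop :=
  ∃ (c : ℂ) (r φ θ : ℝ), 0 < r ∧ θ ≠ 0 ∧ |θ| < 2 * Real.pi ∧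
    ∀ t : ℝ, γ t = c + (r : ℂ) * Complex.exp (((φ + t * θ : ℝ) : ℂ) * Complex.I)

/-- The unit tangent vector of `γ` at its starting point `γ 0`, pointing along the curve. -/
noncomputable def startDirection (γ : ℝ → ℂ) : ℂ :=
  deriv γ 0 / (‖deriv γ 0‖ : ℂ)

/-- A Lombardi drawing of a finite simple graph in the plane `ℂ`: vertices are distinct points,
edges are line segments or circular arcs joining their endpoints and avoiding all other vertices,
and every vertex has perfect angular resolution. For an edge `uv`, `curve u v` and `curve v u`
are the two traversals of one and the same arc (values of `curve` at non-adjacent pairs play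
no role). -/
structure LombardiDrawing {V : Type*} (G : SimpleGraph V) where
  /-- the point representing a vertex -/
  pos : V → ℂ
  /-- the arc of an edge, traversed from the first vertex to the second -/
  curve : V → V → ℝ → ℂ
  pos_injective : Function.Injective pos
  curve_isArc : ∀ u v, G.Adj u v → IsSegmentCurve (curve u v) ∨ IsCircleArcCurve (curve u v)
  curve_zero : ∀ u v, G.Adj u v → curve u v 0 = pos u
  curve_one : ∀ u v, G.Adj u v → curve u v 1 = pos v
  curve_reverse : ∀ u v, G.Adj u v → ∀ t : ℝ, curve v u t = curve u v (1 - t)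
  /-- an edge passes through no vertex other than its endpoints -/
  curve_avoids : ∀ u v w, G.Adj u v → pos w ∈ curve u v '' Set.Icc 0 1 → w = u ∨ w = v
  /-- Perfect angular resolution: the edges at `v` can be numbered `0, …, d - 1`, where `d` is the
  degree of `v`, so that edge number `j` leaves `v` at the angle `ψ + 2πj/d`. -/
  perfect_resolution : ∀ v, ∃ (ψ : ℝ) (σ : G.neighborSet v ≃ Fin (G.neighborSet v).ncard),
    ∀ w : G.neighborSet v, startDirection (curve v w) =
      Complex.exp (((ψ + 2 * Real.pi * ((σ w : ℕ) : ℝ) / ((G.neighborSet v).ncard : ℝ) : ℝ) : ℂ)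
        * Complex.I)

/-- The drawing is planar (crossing-free): the arcs of two different edges have no point in common
except for a common endpoint. -/
def LombardiDrawing.IsPlanar {V : Type*} {G : SimpleGraph V} (D : LombardiDrawing G) : Prop :=
  ∀ u v x y, G.Adj u v → G.Adj x y → s(u, v) ≠ s(x, y) →
    (D.curve u v '' Set.Icc 0 1) ∩ (D.curve x y '' Set.Icc 0 1) ⊆
      {D.pos u, D.pos v} ∩ {D.pos x, D.pos y}

/-- `ApollonianStep S G F`: the plane graph with vertex set `S`, edges those of `G`, and faces
(each of them a triangle, listed with multiplicity and given by its three vertices) `F` arises from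
a triangle, which has an inner and an outer face, by repeatedly placing a new vertex in a
triangular face and joining it to the three vertices of that face. -/
inductive ApollonianStep {V : Type*} [DecidableEq V] :
    Finset V → SimpleGraph V → Multiset (Finset V) → Prop
  | triangle (a b c : V) (hab : a ≠ b) (hbc : b ≠ c) (hac : a ≠ c) :
      ApollonianStep {a, b, c}
        (SimpleGraph.edge a b ⊔ SimpleGraph.edge b c ⊔ SimpleGraph.edge a c)
        ({a, b, c} ::ₘ {a, b, c} ::ₘ 0)
  | stack (S : Finset V) (G : SimpleGraph V) (F : Multiset (Finset V)) (a b c v : V)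
      (h : ApollonianStep S G ({a, b, c} ::ₘ F)) (hv : v ∉ S) :
      ApollonianStep (insert v S)
        (G ⊔ SimpleGraph.edge v a ⊔ SimpleGraph.edge v b ⊔ SimpleGraph.edge v c)
        ({a, b, v} ::ₘ {b, c, v} ::ₘ {a, c, v} ::ₘ F)

/-- A planar 3-tree (Apollonian network) on the vertex type `V`. -/
def IsPlanarThreeTree {V : Type*} [Fintype V] [DecidableEq V] (G : SimpleGraph V) : Prop :=
  ∃ F : Multiset (Finset V), ApollonianStep Finset.univ G F

/-!
A planar 3-tree is exhibited whose angles are incompatible with the angle conditions that hold in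
every circular triangle.

*Triangles.* For a crossing-free triangle made of circular arcs, the sum of two angles on one side
exceeds the third by more than `-π` and less than `3π` (`IsPlanar.triangle_angles`). To see this,
invert at a vertex `q`: the edges at `q` become disjoint rays from points `P` and `W`, the third
edge stays an arc from `P` to `W`. That the three curves do not meet pins down the angles as real
numbers and not just modulo `2π`, and the combination in question is `2χ - π`, where `χ ∈ (0, 2π)`
is the angle from the ray at `P` to the segment `PW`. Consequently a triangle
cannot combine an angle close to `0` at one vertex with an angle close to `2π` at another, measured
on the same side, if its third angle is close to `0` or `2π` too
(`IsPlanar.false_of_mixed_angles`).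

*Rotations.* The order of the edges around a vertex `v` has to be derived from planarity. Two
triangles that share just `v` do not interlace at `v` (`IsPlanar.lt_iff_lt`): after inversion at `v`
they become two disjoint unbounded curves, each made of two rays and an arc; the angle swept by the
first one as seen from a point `z` is a continuous function of `z` off that curve and is determined
modulo `2π`, hence constant along the second curve, and its values at the two ends of the second
curve are read off from the directions of the rays. If the neighbours of `v` other than two
adjacent ones `b` and `c` are linked by a path, the path therefore stays on one side of the
triangle `v b c`, and perfect angular resolution makes `vb` and `vc` consecutive at `v`
(`IsPlanar.consecutive`).

*The graph.* Inside a complete graph on `0, 1, 2, 3` the face `0 1 3` receives a fan of twelve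
vertices joined to `0` and `3`, and the face `1 2 3` a fan of eight vertices joined to `1` and `2`
(`twoFans`). All edges at `0`, `1`, `2` other than those of the triangle `0 1 2` leave on the same
side of it as the edges to `3`, so this triangle forces the rotations at `0` and `1` to have the
same sense. But most edges at `0` go into the triangle `0 1 3`, while most edges at `1` leave it on
the other side, so the triangle `0 1 3` forces the opposite.
-/

open Complex ComplexConjugate

/-! ### Segments and circular arcs -/

/-- The point with parameter `s` of the circular arc from `p` to `w` that leaves `p` in the
direction `κ (w - p)`, for a unit complex number `κ ≠ -1`: as `s` runs through `(0, ∞)`, the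
quotient `(z - p) / (w - z)` runs through the ray spanned by `κ`. -/
noncomputable def arcPoint (p w κ : ℂ) (s : ℝ) : ℂ := (p + s * κ * w) / (1 + s * κ)

theorem one_add_mul_ne_zero {κ : ℂ} (hκ : ‖κ‖ = 1) (h1 : κ ≠ -1) {s : ℝ} (hs : 0 ≤ s) :
    1 + (s : ℂ) * κ ≠ 0 := by
  intro h
  have h2 : (s : ℂ) * κ = -1 := by linear_combination h
  have h3 : s = 1 := by
    have := congrArg norm h2
    simpa [hκ, abs_of_nonneg hs] using this
  subst h3
  exact h1 (by simpa using h2)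

theorem segment_startDirection {γ : ℝ → ℂ} {p q : ℂ} (h : ∀ t : ℝ, γ t = p + (t : ℂ) * (q - p)) :
    startDirection γ = (q - p) / ‖q - p‖ := by
  have hd : HasDerivAt γ (q - p) 0 := by
    have h1 : HasDerivAt (fun t : ℝ => p + (t : ℂ) * (q - p)) (0 + 1 * (q - p)) 0 :=
      (hasDerivAt_const _ _).add ((HasDerivAt.ofReal_comp (hasDerivAt_id (0 : ℝ))).mul_const _)
    rw [funext h]
    simpa using h1
  rw [startDirection, hd.deriv]

theorem sub_eq_of_circle {c : ℂ} {r φ θ : ℝ} :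
    (c + (r : ℂ) * exp (((φ + 1 * θ : ℝ) : ℂ) * I)) - (c + (r : ℂ) * exp (((φ + 0 * θ : ℝ) : ℂ) * I))
      = ((2 * r * Real.sin (θ / 2) : ℝ) : ℂ) * (I * exp (((φ + θ / 2 : ℝ) : ℂ) * I)) := by
  have e1 : exp (((φ + 1 * θ : ℝ) : ℂ) * I)
      = exp (((φ + θ / 2 : ℝ) : ℂ) * I) * exp (((θ / 2 : ℝ) : ℂ) * I) := by
    rw [← Complex.exp_add]; congr 1; push_cast; ring
  have e2 : exp (((φ + 0 * θ : ℝ) : ℂ) * I)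
      = exp (((φ + θ / 2 : ℝ) : ℂ) * I) * exp (-((θ / 2 : ℝ) : ℂ) * I) := by
    rw [← Complex.exp_add]; congr 1; push_cast; ring
  rw [e1, e2]
  push_cast
  rw [Complex.sin]
  linear_combination (-(r : ℂ) * exp (((φ : ℂ) + θ / 2) * I) *
    (exp (-((θ : ℂ) / 2) * I) - exp ((θ : ℂ) / 2 * I))) * I_sq

theorem circle_startDirection {γ : ℝ → ℂ} {c : ℂ} {r φ θ : ℝ} (hr : 0 < r) (hθ : θ ≠ 0)
    (hθ' : |θ| < 2 * Real.pi)
    (h : ∀ t : ℝ, γ t = c + (r : ℂ) * exp (((φ + t * θ : ℝ) : ℂ) * I)) :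
    γ 0 ≠ γ 1 ∧
      startDirection γ = exp (((-(θ / 2) : ℝ) : ℂ) * I) * ((γ 1 - γ 0) / ‖γ 1 - γ 0‖) := by
  have hd : HasDerivAt γ ((r : ℂ) * (exp (((φ + 0 * θ : ℝ) : ℂ) * I) * (θ * I))) 0 := by
    have h1 : HasDerivAt (fun t : ℝ => φ + t * θ) (1 * θ) (0 : ℝ) :=
      ((hasDerivAt_id (0 : ℝ)).mul_const θ).const_add φ
    have h2 := (((h1.ofReal_comp).mul_const I).cexp.const_mul (r : ℂ)).const_add c
    rw [funext h]
    simpa using h2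
  have hpos : 0 < θ * Real.sin (θ / 2) := by
    rw [abs_lt] at hθ'
    rcases hθ.lt_or_gt with h0 | h0
    · exact mul_pos_of_neg_of_neg h0 (Real.sin_neg_of_neg_of_neg_pi_lt (by linarith) (by linarith))
    · exact mul_pos h0 (Real.sin_pos_of_pos_of_lt_pi (by linarith) (by linarith))
  have hs : Real.sin (θ / 2) ≠ 0 := by
    intro h0; rw [h0] at hpos; simp at hpos
  have hsub : γ 1 - γ 0 =
      ((2 * r * Real.sin (θ / 2) : ℝ) : ℂ) * (I * exp (((φ + θ / 2 : ℝ) : ℂ) * I)) := by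
    rw [h 1, h 0]; exact sub_eq_of_circle
  have hn : ‖γ 1 - γ 0‖ = 2 * r * |Real.sin (θ / 2)| := by
    rw [hsub, norm_mul, norm_mul, Complex.norm_exp_ofReal_mul_I, Complex.norm_real]
    simp [abs_of_pos hr]
  refine ⟨fun h0 => ?_, ?_⟩
  · rw [h0, sub_self, norm_zero] at hn
    have := abs_pos.mpr hs
    nlinarith
  · rw [startDirection, hd.deriv, hn, hsub]
    have e2 : exp (((φ + 0 * θ : ℝ) : ℂ) * I)
        = exp (((φ + θ / 2 : ℝ) : ℂ) * I) * exp (((-(θ / 2) : ℝ) : ℂ) * I) := by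
      rw [← Complex.exp_add]; congr 1; push_cast; ring
    have hn2 : ‖(r : ℂ) * (exp (((φ + 0 * θ : ℝ) : ℂ) * I) * (θ * I))‖ = r * |θ| := by
      rw [norm_mul, norm_mul, Complex.norm_exp_ofReal_mul_I, norm_mul, Complex.norm_real,
        Complex.norm_real]
      simp [abs_of_pos hr]
    rw [hn2, e2]
    have key : (Real.sin (θ / 2) : ℂ) * (|θ| : ℝ) = θ * (|Real.sin (θ / 2)| : ℝ) := by
      norm_cast
      rcases hθ.lt_or_gt with h0 | h0
      · have : Real.sin (θ / 2) < 0 := by nlinarith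
        rw [abs_of_neg h0, abs_of_neg this]; ring
      · have : 0 < Real.sin (θ / 2) := by nlinarith
        rw [abs_of_pos h0, abs_of_pos this]; ring
    have a1 : ((|θ| : ℝ) : ℂ) ≠ 0 := by exact_mod_cast (abs_pos.mpr hθ).ne'
    have a2 : ((|Real.sin (θ / 2)| : ℝ) : ℂ) ≠ 0 := by exact_mod_cast (abs_pos.mpr hs).ne'
    have a3 : (r : ℂ) ≠ 0 := by exact_mod_cast hr.ne'
    push_cast at *
    field_simp
    linear_combination (-1 : ℂ) * key

/-- The argument of `1 + s e^{iβ}` lies between `0` and `β`. -/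
theorem exists_arg_one_add {β s : ℝ} (hβ : |β| < Real.pi) (hs : 0 < s) :
    ∃ t ∈ Set.Icc (0 : ℝ) 1, ∃ ρ : ℝ, 0 < ρ ∧
      1 + (s : ℂ) * exp ((β : ℂ) * I) = ρ * exp (((t * β : ℝ) : ℂ) * I) := by
  -- the case `0 < β` suffices, by complex conjugation
  wlog h0 : 0 ≤ β generalizing β
  · obtain ⟨t, ht, ρ, hρ, h⟩ := this (β := -β) (by rwa [abs_neg]) (by linarith)
    refine ⟨t, ht, ρ, hρ, ?_⟩
    have := congrArg conj h
    simp only [map_add, map_one, map_mul, Complex.conj_ofReal, ← Complex.exp_conj, conj_I] at this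
    convert this using 3 <;> push_cast <;> ring_nf
  rcases h0.eq_or_lt with rfl | h0
  · refine ⟨0, by simp, 1 + s, by linarith, by simp⟩
  rw [abs_of_pos h0] at hβ
  set x := 1 + (s : ℂ) * exp ((β : ℂ) * I) with hx
  have hsin : 0 < Real.sin β := Real.sin_pos_of_pos_of_lt_pi h0 hβ
  have him : 0 < x.im := by
    simp only [hx, add_im, one_im, zero_add, im_ofReal_mul, exp_ofReal_mul_I_im]
    positivity
  have hx0 : x ≠ 0 := by intro h; rw [h] at him; simp at him
  have ha : 0 < x.arg := by
    have h1 : 0 ≤ x.arg := Complex.arg_nonneg_iff.mpr him.le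
    refine lt_of_le_of_ne h1 (fun h => ?_)
    have := Complex.arg_eq_zero_iff.mp h.symm
    exact him.ne' this.2
  have hxe : x = ‖x‖ * exp (x.arg * I) := (Complex.norm_mul_exp_arg_mul_I x).symm
  have hab : x.arg ≤ β := by
    by_contra! hlt
    have h2 : x * exp (((-β : ℝ) : ℂ) * I) = ‖x‖ * exp (((x.arg - β : ℝ) : ℂ) * I) := by
      nth_rewrite 1 [hxe]
      rw [mul_assoc, ← Complex.exp_add]; congr 2; push_cast; ring
    have h3 : x * exp (((-β : ℝ) : ℂ) * I) = exp (((-β : ℝ) : ℂ) * I) + s := by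
      rw [hx, add_mul, one_mul, mul_assoc, ← Complex.exp_add]
      have : (β : ℂ) * I + ((-β : ℝ) : ℂ) * I = 0 := by push_cast; ring
      rw [this]; simp
    have h4 := congrArg Complex.im (h2.symm.trans h3)
    simp only [add_im, im_ofReal_mul, exp_ofReal_mul_I_im, ofReal_im, Real.sin_neg] at h4
    have h5 : 0 < Real.sin (x.arg - β) :=
      Real.sin_pos_of_pos_of_lt_pi (by linarith) (by linarith [Complex.arg_le_pi x])
    have : 0 < ‖x‖ := norm_pos_iff.mpr hx0
    nlinarith [mul_pos this h5]
  refine ⟨x.arg / β, ⟨by positivity, (div_le_one h0).mpr hab⟩, ‖x‖, norm_pos_iff.mpr hx0, ?_⟩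
  rw [div_mul_cancel₀ _ h0.ne']
  exact hxe

/-- The algebraic description of segments and circular arcs: a single unit complex number `κ`
(the deviation of the arc from its chord) gives the points and the two end directions. -/
theorem exists_arc_of_curve {γ : ℝ → ℂ} (h : IsSegmentCurve γ ∨ IsCircleArcCurve γ) :
    ∃ κ : ℂ, ‖κ‖ = 1 ∧ κ ≠ -1 ∧
      startDirection γ = κ * ((γ 1 - γ 0) / ‖γ 1 - γ 0‖) ∧
      startDirection (fun t => γ (1 - t)) = conj κ * ((γ 0 - γ 1) / ‖γ 0 - γ 1‖) ∧
      ∀ s : ℝ, 0 < s → arcPoint (γ 0) (γ 1) κ s ∈ γ '' Set.Icc 0 1 := by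
  rcases h with ⟨p, q, hpq, h⟩ | ⟨c, r, φ, θ, hr, hθ, hθ', h⟩
  · have h0 : γ 0 = p := by simp [h 0]
    have h1 : γ 1 = q := by simp [h 1]
    refine ⟨1, by simp, by norm_num, ?_, ?_, ?_⟩
    · rw [segment_startDirection h, h0, h1, one_mul]
    · rw [segment_startDirection (p := q) (q := p), h0, h1, map_one, one_mul]
      intro t; rw [h]; push_cast; ring
    · intro s hs
      refine ⟨s / (1 + s), ⟨by positivity, (div_le_one (by positivity)).mpr (by linarith)⟩, ?_⟩
      have : (1 + s : ℂ) ≠ 0 := by exact_mod_cast (by positivity : (1 + s : ℝ) ≠ 0)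
      rw [h, h0, h1, arcPoint]
      push_cast
      rw [mul_one]
      field_simp
      ring
  · obtain ⟨hne, hdir⟩ := circle_startDirection hr hθ hθ' h
    have h' : ∀ t : ℝ, (fun t => γ (1 - t)) t =
        c + (r : ℂ) * exp ((((φ + θ) + t * (-θ) : ℝ) : ℂ) * I) := by
      intro t; simp only [h]; push_cast; ring_nf
    obtain ⟨-, hdir'⟩ := circle_startDirection hr (neg_ne_zero.mpr hθ) (by rwa [abs_neg]) h'
    have hb : |θ / 2| < Real.pi := by rw [abs_div, abs_two]; linarith
    refine ⟨exp (((-(θ / 2) : ℝ) : ℂ) * I), Complex.norm_exp_ofReal_mul_I _, ?_, hdir, ?_, ?_⟩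
    · intro he
      have hc := congrArg Complex.re he
      rw [exp_ofReal_mul_I_re, Real.cos_neg] at hc
      have := abs_lt.mp hb
      have hcos : Real.cos (θ / 4) ≠ 0 :=
        (Real.cos_pos_of_mem_Ioo ⟨by linarith, by linarith⟩).ne'
      have h2 : Real.cos (θ / 2) = 2 * Real.cos (θ / 4) ^ 2 - 1 := by
        rw [← Real.cos_two_mul]; congr 1; ring
      rw [h2] at hc
      simp only [neg_re, one_re] at hc
      exact hcos (by nlinarith)
    · rw [hdir']
      congr 1
      · rw [← Complex.exp_conj]; simp only [map_mul, conj_I, conj_ofReal]; congr 1; push_cast; ring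
      · simp
    · intro s hs
      obtain ⟨t, ht, ρ, hρ, hE⟩ := exists_arg_one_add hb hs
      refine ⟨t, ht, ?_⟩
      have hE' : 1 + (s : ℂ) * exp (((-(θ / 2) : ℝ) : ℂ) * I)
          = ρ * exp (((-(t * (θ / 2)) : ℝ) : ℂ) * I) := by
        have := congrArg conj hE
        simp only [map_add, map_one, map_mul, conj_ofReal, ← Complex.exp_conj, conj_I] at this
        convert this using 3 <;> push_cast <;> ring_nf
      have hρ' : (ρ : ℂ) ≠ 0 := by exact_mod_cast hρ.ne'
      rw [arcPoint, hE', eq_div_iff (mul_ne_zero hρ' (Complex.exp_ne_zero _)), h t, h 0, h 1]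
      have e1 : exp (((φ + 1 * θ : ℝ) : ℂ) * I) * exp (((-(θ / 2) : ℝ) : ℂ) * I)
          = exp ((φ : ℂ) * I) * exp (((θ / 2 : ℝ) : ℂ) * I) := by
        rw [← Complex.exp_add, ← Complex.exp_add]; congr 1; push_cast; ring
      have e2 : exp (((φ + t * θ : ℝ) : ℂ) * I) * exp (((-(t * (θ / 2)) : ℝ) : ℂ) * I)
          = exp ((φ : ℂ) * I) * exp (((t * (θ / 2) : ℝ) : ℂ) * I) := by
        rw [← Complex.exp_add, ← Complex.exp_add]; congr 1; push_cast; ring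
      have e0 : exp (((φ + 0 * θ : ℝ) : ℂ) * I) = exp ((φ : ℂ) * I) := by
        congr 2; push_cast; ring
      rw [e0]
      linear_combination (-c) * hE' + (r : ℂ) * ρ * e2 - (r : ℂ) * s * e1
        - (r : ℂ) * exp ((φ : ℂ) * I) * hE

/-! ### Edges of a Lombardi drawing -/

namespace LombardiDrawing
variable {V : Type*} {G : SimpleGraph V} (D : LombardiDrawing G)

/-- The direction in which the edge from `u` to `v` leaves `u`. -/
noncomputable def dir (u v : V) : ℂ := startDirection (D.curve u v)

/-- The closed arc that represents the edge `uv`. -/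
def edgeSet (u v : V) : Set ℂ := D.curve u v '' Set.Icc 0 1

variable {D}

theorem right_mem_edgeSet {u v : V} (h : G.Adj u v) : D.pos v ∈ D.edgeSet u v :=
  ⟨1, by simp, D.curve_one u v h⟩

theorem pos_sub_ne_zero {u v : V} (h : u ≠ v) : D.pos u - D.pos v ≠ 0 :=
  sub_ne_zero.mpr (fun e => h (D.pos_injective e))

theorem exists_arc {u v : V} (h : G.Adj u v) :
    ∃ κ : ℂ, ‖κ‖ = 1 ∧ κ ≠ -1 ∧
      D.dir u v = κ * ((D.pos v - D.pos u) / ‖D.pos v - D.pos u‖) ∧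
      D.dir v u = conj κ * ((D.pos u - D.pos v) / ‖D.pos u - D.pos v‖) ∧
      ∀ s : ℝ, 0 < s → arcPoint (D.pos u) (D.pos v) κ s ∈ D.edgeSet u v := by
  obtain ⟨κ, h1, h2, h3, h4, h5⟩ := exists_arc_of_curve (D.curve_isArc u v h)
  rw [← funext (D.curve_reverse u v h)] at h4
  rw [D.curve_zero u v h, D.curve_one u v h] at h3 h4 h5
  exact ⟨κ, h1, h2, h3, h4, h5⟩

theorem norm_dir {u v : V} (h : G.Adj u v) : ‖D.dir u v‖ = 1 := by
  obtain ⟨κ, h1, -, h3, -, -⟩ := exists_arc (D := D) h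
  rw [h3, norm_mul, h1, norm_div, norm_real, norm_norm, one_mul, div_self]
  exact norm_ne_zero_iff.mpr (pos_sub_ne_zero h.ne')

/-! ### Inversion at a vertex -/

variable (D) in
/-- The image of the vertex `v` under the inversion `z ↦ (z - q)⁻¹`, where `q` stands for the
point representing the vertex `q`. -/
noncomputable def inv (q v : V) : ℂ := (D.pos v - D.pos q)⁻¹

theorem inv_vertex_ne_zero {q v : V} (h : v ≠ q) : D.inv q v ≠ 0 := inv_ne_zero (pos_sub_ne_zero h)

/-- Inversion at `q` turns an edge at `q` into a ray; complex conjugation of the direction accounts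
for the reversal of orientation at infinity. -/
theorem ray_mem_edgeSet {q v : V} (h : G.Adj q v) {t : ℝ} (ht : 0 ≤ t) :
    D.inv q v + t * conj (D.dir q v) ≠ 0 ∧
      D.pos q + (D.inv q v + t * conj (D.dir q v))⁻¹ ∈ D.edgeSet q v := by
  have ha := pos_sub_ne_zero (D := D) h.ne'
  rcases ht.eq_or_lt with rfl | ht
  · simp only [ofReal_zero, zero_mul, add_zero]
    refine ⟨inv_vertex_ne_zero h.ne', ?_⟩
    rw [inv, inv_inv, add_sub_cancel]
    exact right_mem_edgeSet h
  obtain ⟨κ, h1, h2, h3, -, h5⟩ := exists_arc (D := D) h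
  rw [h3, inv]
  set a := D.pos v - D.pos q with hadef
  have hn : (0 : ℝ) < ‖a‖ := norm_pos_iff.mpr ha
  set s : ℝ := 1 / (t * ‖a‖) with hs
  have hs0 : 0 < s := by positivity
  have h6 := one_add_mul_ne_zero h1 h2 hs0.le
  have hκ0 : κ ≠ 0 := by rintro rfl; simp at h1
  have hconj : ∀ x : ℂ, x ≠ 0 → conj x = ‖x‖ ^ 2 / x := by
    intro x hx; rw [eq_div_iff hx, mul_comm, Complex.mul_conj, normSq_eq_norm_sq]; push_cast; ring
  have hn' : (‖a‖ : ℂ) ≠ 0 := by exact_mod_cast hn.ne'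
  have ht' : (t : ℂ) ≠ 0 := by exact_mod_cast ht.ne'
  have hs' : (s : ℂ) ≠ 0 := by exact_mod_cast hs0.ne'
  have hst : (s : ℂ) * (t * ‖a‖) = 1 := by
    rw [hs]; push_cast; field_simp
  have key : a⁻¹ + t * conj (κ * (a / ‖a‖)) = (1 + s * κ) / (s * κ * a) := by
    rw [map_mul, map_div₀, conj_ofReal, hconj κ hκ0, hconj a ha, h1]
    field_simp
    push_cast
    linear_combination (1 : ℂ) * hst
  rw [key]
  refine ⟨div_ne_zero h6 (by positivity), ?_⟩
  convert h5 s hs0 using 1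
  rw [arcPoint, inv_div, eq_div_iff h6, add_mul, div_mul_cancel₀ _ h6, hadef]
  ring

/-- Inversion at a vertex `q` turns an edge `uv` that avoids `q` into an arc. As the inversion is
conformal, the arc forms the same angles with the rays that come from the edges at `q`; this is the
content of the last two clauses. -/
theorem arc_mem_edgeSet {q u v : V} (h : G.Adj u v) (hu : u ≠ q) (hv : v ≠ q) :
    ∃ κ : ℂ, ‖κ‖ = 1 ∧ κ ≠ -1 ∧
      (∀ s : ℝ, 0 < s → arcPoint (D.inv q u) (D.inv q v) κ s ≠ 0 ∧
        D.pos q + (arcPoint (D.inv q u) (D.inv q v) κ s)⁻¹ ∈ D.edgeSet u v) ∧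
      (G.Adj q u → D.dir u v * conj (D.dir q u) =
        D.dir u q * (κ * ((D.inv q v - D.inv q u) / ‖D.inv q v - D.inv q u‖))) ∧
      (G.Adj q v → D.dir v u * conj (D.dir q v) =
        D.dir v q * (conj κ * ((D.inv q u - D.inv q v) / ‖D.inv q v - D.inv q u‖))) := by
  obtain ⟨κ, h1, h2, h3, h4, h5⟩ := exists_arc (D := D) h
  have ha := pos_sub_ne_zero (D := D) hu
  have hb := pos_sub_ne_zero (D := D) hv
  have hc := pos_sub_ne_zero (D := D) h.ne
  have hq : D.pos q ∉ D.edgeSet u v := fun hm => by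
    rcases D.curve_avoids u v q h hm with rfl | rfl
    · exact hu rfl
    · exact hv rfl
  have hconj : ∀ x : ℂ, x ≠ 0 → conj x = ‖x‖ ^ 2 / x := by
    intro x hx; rw [eq_div_iff hx, mul_comm, Complex.mul_conj, normSq_eq_norm_sq]; push_cast; ring
  have hdirq : ∀ w : V, G.Adj q w → D.dir w q =
      - conj (D.dir q w) * ((D.pos w - D.pos q) / ‖D.pos w - D.pos q‖) ^ 2 := by
    intro w hw
    obtain ⟨μ, g1, -, g3, g4, -⟩ := exists_arc (D := D) hw
    have hw0 := pos_sub_ne_zero (D := D) hw.ne'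
    have hwn : (‖D.pos w - D.pos q‖ : ℂ) ≠ 0 := by exact_mod_cast norm_ne_zero_iff.mpr hw0
    rw [g4, g3, norm_sub_rev (D.pos q), map_mul, map_div₀, conj_ofReal, hconj _ hw0]
    field_simp
    ring
  simp only [inv]
  have hba : D.pos u - D.pos v = (D.pos u - D.pos q) - (D.pos v - D.pos q) := by ring
  have hab : D.pos v - D.pos u = (D.pos v - D.pos q) - (D.pos u - D.pos q) := by ring
  rw [hba] at hc
  rw [hab] at h3
  rw [hba] at h4
  have hau : D.pos u = D.pos q + (D.pos u - D.pos q) := by ring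
  have hav : D.pos v = D.pos q + (D.pos v - D.pos q) := by ring
  rw [hau, hav] at h5
  have hdu := hdirq u
  have hdv := hdirq v
  generalize D.pos u - D.pos q = a at *
  generalize D.pos v - D.pos q = b at *
  have hna : (0 : ℝ) < ‖a‖ := norm_pos_iff.mpr ha
  have hnb : (0 : ℝ) < ‖b‖ := norm_pos_iff.mpr hb
  have hna' : (‖a‖ : ℂ) ≠ 0 := by exact_mod_cast hna.ne'
  have hnb' : (‖b‖ : ℂ) ≠ 0 := by exact_mod_cast hnb.ne'
  have hκ0 : κ ≠ 0 := by rintro rfl; simp at h1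
  have hnc : (‖a - b‖ : ℂ) ≠ 0 := by exact_mod_cast norm_ne_zero_iff.mpr hc
  have hninv : (‖b⁻¹ - a⁻¹‖ : ℂ) = ‖a - b‖ / (‖a‖ * ‖b‖) := by
    have : b⁻¹ - a⁻¹ = (a - b) / (a * b) := by field_simp
    rw [this, norm_div, norm_mul]; push_cast; ring
  -- the sum below vanishes only if the arc passes through `q`
  have hsum : ∀ r : ℝ, 0 < r → a + r * κ * b ≠ 0 := by
    intro r hr h0
    apply hq
    have := h5 r hr
    have h6 := one_add_mul_ne_zero h1 h2 hr.le
    rwa [arcPoint, show D.pos q + a + r * κ * (D.pos q + b)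
      = D.pos q * (1 + r * κ) + (a + r * κ * b) by ring, h0, add_zero,
      mul_div_cancel_right₀ _ h6] at this
  set μ : ℂ := κ * ((b / ‖b‖) / (a / ‖a‖)) with hμ
  refine ⟨μ, ?_, ?_, ?_, ?_, ?_⟩
  · rw [hμ, norm_mul, h1, norm_div, norm_div, norm_div, norm_real, norm_real, norm_norm, norm_norm,
      div_self hna.ne', div_self hnb.ne']
    simp
  · intro he
    refine hsum (‖a‖ / ‖b‖) (by positivity) ?_
    rw [hμ] at he
    field_simp at he
    push_cast
    field_simp
    linear_combination he
  · intro s hs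
    have hr : 0 < s * ‖a‖ / ‖b‖ := by positivity
    have hs' : (s : ℂ) ≠ 0 := by exact_mod_cast hs.ne'
    have h7 := hsum _ hr
    have h8 := h5 _ hr
    have h6 := one_add_mul_ne_zero h1 h2 hr.le
    set r : ℝ := s * ‖a‖ / ‖b‖ with hrdef
    have hsμ : (s : ℂ) * μ = r * κ * b / a := by
      rw [hμ, hrdef]; push_cast; field_simp
    have key : arcPoint a⁻¹ b⁻¹ μ s = (1 + r * κ) / (a + r * κ * b) := by
      rw [arcPoint, hsμ]
      have h9 : 1 + r * κ * b / a = (a + r * κ * b) / a := by field_simp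
      rw [h9]
      field_simp
    rw [key]
    refine ⟨div_ne_zero h6 h7, ?_⟩
    convert h8 using 1
    rw [arcPoint, inv_div, eq_div_iff h6, add_mul, div_mul_cancel₀ _ h6]
    ring
  · intro hqu
    rw [hdu hqu, h3, hninv, norm_sub_rev b a, hμ]
    field_simp
    ring
  · intro hqv
    rw [hdv hqv, h4, hninv, hμ, map_mul, map_div₀, map_div₀, map_div₀, conj_ofReal, conj_ofReal,
      hconj a ha, hconj b hb]
    field_simp
    ring

end LombardiDrawing

/-! ### The angles of a circular triangle -/

/-- Distinct unit complex numbers differ by an angle strictly between `0` and `2π`. -/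
theorem exists_angle {a b : ℂ} (ha : ‖a‖ = 1) (hb : ‖b‖ = 1) (h : a ≠ b) :
    ∃ x : ℝ, 0 < x ∧ x < 2 * Real.pi ∧ b = a * exp (x * I) := by
  have ha0 : a ≠ 0 := by rintro rfl; simp at ha
  have hn : ‖b / a‖ = 1 := by rw [norm_div, ha, hb]; simp
  have he : b / a = exp ((b / a).arg * I) := by
    have := Complex.norm_mul_exp_arg_mul_I (b / a)
    rw [hn] at this; simpa using this.symm
  have hb' : b = a * exp ((b / a).arg * I) := by rw [← he]; field_simp
  rcases lt_trichotomy (b / a).arg 0 with h0 | h0 | h0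
  · refine ⟨(b / a).arg + 2 * Real.pi, by linarith [Complex.neg_pi_lt_arg (b / a), Real.pi_pos],
      by linarith, ?_⟩
    push_cast
    rw [add_mul, Complex.exp_add, Complex.exp_two_pi_mul_I, mul_one]
    exact hb'
  · rw [h0] at hb'; simp at hb'; exact absurd hb'.symm h
  · exact ⟨_, h0, by linarith [Complex.arg_le_pi (b / a), Real.pi_pos], hb'⟩

theorem angle_unique {x y : ℝ} (hx : 0 < x) (hx' : x < 2 * Real.pi) (hy : 0 ≤ y)
    (hy' : y ≤ 2 * Real.pi) (h : exp (x * I) = exp (y * I)) : x = y := by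
  obtain ⟨n, hn⟩ := Complex.exp_eq_exp_iff_exists_int.mp h
  have h1 : (x : ℂ) = y + n * (2 * Real.pi) := by
    apply mul_right_cancel₀ I_ne_zero
    linear_combination hn
  have h2 : x = y + n * (2 * Real.pi) := by exact_mod_cast h1
  have hp := Real.pi_pos
  have h3 : n < 1 := by
    by_contra! hc
    have : (1 : ℝ) ≤ n := by exact_mod_cast hc
    nlinarith
  have h4 : -1 < n := by
    by_contra! hc
    have : (n : ℝ) ≤ -1 := by exact_mod_cast hc
    nlinarith
  have : n = 0 := by omega
  subst this
  simpa using h2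

theorem exp_angle_ne_one {x : ℝ} (hx : 0 < x) (hx' : x < 2 * Real.pi) : exp (x * I) ≠ 1 := by
  intro h
  refine hx.ne' (angle_unique hx hx' le_rfl (by positivity) ?_)
  rw [h]; simp

/-- As `s` runs through the positive reals, the argument of `e^{iχ} (1 + s e^{iδ})` sweeps the
interval between `χ` and `χ + δ`; if it never meets the positive real axis, this interval does
not leave `[0, 2π]`. -/
theorem add_mem_Icc_of_sweep {χ δ : ℝ} (hχ : 0 < χ) (hχ' : χ < 2 * Real.pi) (hδ : -Real.pi < δ)
    (hδ' : δ < Real.pi)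
    (h : ∀ s r : ℝ, 0 < s → 0 < r → exp (χ * I) * (1 + s * exp (δ * I)) ≠ r) :
    0 ≤ χ + δ ∧ χ + δ ≤ 2 * Real.pi := by
  have key : ∀ χ δ : ℝ, 0 < χ → χ < 2 * Real.pi → -Real.pi < δ → δ < Real.pi → χ + δ < 0 →
      ∃ s r : ℝ, 0 < s ∧ 0 < r ∧ exp (χ * I) * (1 + s * exp (δ * I)) = r := by
    intro χ δ h1 h2 h3 h4 h5
    have s1 : 0 < Real.sin χ := Real.sin_pos_of_pos_of_lt_pi h1 (by linarith)
    have s2 : Real.sin (χ + δ) < 0 := Real.sin_neg_of_neg_of_neg_pi_lt h5 (by linarith)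
    have s2' := s2.ne
    have s3 : Real.sin δ < 0 := Real.sin_neg_of_neg_of_neg_pi_lt (by linarith) (by linarith)
    refine ⟨-Real.sin χ / Real.sin (χ + δ), Real.sin δ / Real.sin (χ + δ),
      div_pos_of_neg_of_neg (by linarith) s2, div_pos_of_neg_of_neg s3 s2, ?_⟩
    have e : exp (χ * I) * exp (δ * I) = exp (((χ + δ : ℝ) : ℂ) * I) := by
      rw [← Complex.exp_add]; congr 1; push_cast; ring
    rw [mul_add, mul_one, mul_left_comm, e]
    have hd : Real.sin δ = Real.sin (χ + δ) * Real.cos χ - Real.cos (χ + δ) * Real.sin χ := by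
      rw [← Real.sin_sub]; congr 1; ring
    apply Complex.ext
    · simp only [add_re, exp_ofReal_mul_I_re, re_ofReal_mul, ofReal_re]
      rw [hd]; field_simp; ring
    · simp only [add_im, exp_ofReal_mul_I_im, im_ofReal_mul, ofReal_im]
      field_simp; ring
  constructor
  · by_contra! hc
    obtain ⟨s, r, hs, hr, he⟩ := key χ δ hχ hχ' hδ hδ' hc
    exact h s r hs hr he
  · by_contra! hc
    obtain ⟨s, r, hs, hr, he⟩ := key (2 * Real.pi - χ) (-δ) (by linarith) (by linarith)
      (by linarith) (by linarith) (by linarith)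
    refine h s r hs hr ?_
    have := congrArg conj he
    simp only [map_mul, map_add, map_one, conj_ofReal, ← Complex.exp_conj, conj_I] at this
    rw [← this]
    congr 1
    · rw [show ((2 * Real.pi - χ : ℝ) : ℂ) * -I = χ * I - 2 * Real.pi * I by push_cast; ring,
        Complex.exp_sub, Complex.exp_two_pi_mul_I, div_one]
    · congr 3; push_cast; ring

theorem arcPoint_sub_left {P W κ : ℂ} (hκ : ‖κ‖ = 1) (h1 : κ ≠ -1) {s : ℝ} (hs : 0 < s) :
    arcPoint P W κ (1 / s) = P + (W - P) / (1 + s * conj κ) := by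
  have h := one_add_mul_ne_zero hκ h1 (one_div_pos.mpr hs).le
  have h2 := one_add_mul_ne_zero (κ := conj κ) (by simpa using hκ)
    (fun e => h1 (by simpa using congrArg conj e)) hs.le
  have hk : κ * conj κ = 1 := by rw [Complex.mul_conj, normSq_eq_norm_sq, hκ]; simp
  have hs' : (s : ℂ) ≠ 0 := by exact_mod_cast hs.ne'
  have hss : ((1 / s : ℝ) : ℂ) * s = 1 := by push_cast; field_simp
  rw [arcPoint, div_eq_iff h, add_mul, div_mul_eq_mul_div, ← sub_eq_iff_eq_add',
    eq_div_iff h2]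
  linear_combination (W - P) * (κ * conj κ * hss + hk)

theorem arcPoint_sub_right {P W κ : ℂ} (hκ : ‖κ‖ = 1) (h1 : κ ≠ -1) {s : ℝ} (hs : 0 < s) :
    arcPoint P W κ s = W - (W - P) / (1 + s * κ) := by
  have h := one_add_mul_ne_zero hκ h1 hs.le
  rw [arcPoint]
  field_simp
  ring

theorem arcPoint_ne_left {P W κ : ℂ} (hκ : ‖κ‖ = 1) (h1 : κ ≠ -1) (hPW : P ≠ W) {s : ℝ}
    (hs : 0 < s) : arcPoint P W κ s ≠ P := by
  have h := one_add_mul_ne_zero hκ h1 hs.le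
  have hs' : (s : ℂ) ≠ 0 := by exact_mod_cast hs.ne'
  have hk : κ ≠ 0 := by rintro rfl; simp at hκ
  rw [arcPoint, Ne, div_eq_iff h]
  intro e
  exact hPW (mul_left_cancel₀ (mul_ne_zero hs' hk) (by linear_combination -e))

theorem arcPoint_ne_right {P W κ : ℂ} (hκ : ‖κ‖ = 1) (h1 : κ ≠ -1) (hPW : P ≠ W) {s : ℝ}
    (hs : 0 < s) : arcPoint P W κ s ≠ W := by
  have h := one_add_mul_ne_zero hκ h1 hs.le
  rw [arcPoint, Ne, div_eq_iff h]
  exact fun e => hPW (by linear_combination e)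

/-- A circular triangle with one vertex at infinity. Two disjoint rays start at `P` and `W` and an
arc joins `P` to `W`. The argument `χ` of `W - P` relative to the ray at `P` is expressed by the
three angles, as `2χ = φ + θ - ψ + π`. -/
theorem angle_bounds_of_rays {P W κ a b : ℂ} {φ θ ψ : ℝ} (hPW : P ≠ W) (ha : ‖a‖ = 1)
    (hb : ‖b‖ = 1) (hκ : ‖κ‖ = 1) (hκ1 : κ ≠ -1)
    (h1 : ∀ s t : ℝ, 0 < s → 0 ≤ t → arcPoint P W κ s ≠ P + t * a)
    (h2 : ∀ s t : ℝ, 0 < s → 0 ≤ t → arcPoint P W κ s ≠ W + t * b)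
    (h3 : ∀ s t : ℝ, 0 ≤ s → 0 ≤ t → P + s * a ≠ W + t * b)
    (hφ : 0 < φ) (hφ' : φ < 2 * Real.pi) (hθ : 0 < θ) (hθ' : θ < 2 * Real.pi)
    (hψ : 0 < ψ) (hψ' : ψ < 2 * Real.pi)
    (dφ : κ * ((W - P) / ‖W - P‖) = exp (φ * I) * a) (dθ : b = exp (θ * I) * a)
    (dψ : b = exp (ψ * I) * (conj κ * ((P - W) / ‖W - P‖))) :
    -Real.pi < φ + θ - ψ ∧ φ + θ - ψ < 3 * Real.pi := by
  have hn : 0 < ‖W - P‖ := norm_pos_iff.mpr (sub_ne_zero.mpr hPW.symm)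
  set ρ := ‖W - P‖ with hρ
  have hρ0 : (ρ : ℂ) ≠ 0 := by exact_mod_cast hn.ne'
  have ha0 : a ≠ 0 := by rintro rfl; simp at ha
  have hU : ‖(W - P) / ρ‖ = 1 := by
    rw [norm_div, norm_real, Real.norm_of_nonneg hn.le, ← hρ, div_self hn.ne']
  obtain ⟨χ, c1, c2, c3⟩ := exists_angle ha hU (by
    intro e
    refine h3 ρ 0 hn.le le_rfl ?_
    rw [e]; push_cast; field_simp; ring)
  obtain ⟨ζ, z1, z2, z3⟩ := exists_angle (b := -b) hU (by simpa using hb) (by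
    intro e
    refine h3 0 ρ le_rfl hn.le ?_
    have : b = - ((W - P) / ρ) := by rw [e]; ring
    rw [this]; push_cast; field_simp; ring)
  have hWP : W - P = ρ * (a * exp (χ * I)) := by rw [← c3]; field_simp
  have hbb : b = -(a * exp (χ * I) * exp (ζ * I)) := by rw [← c3, ← z3]; ring
  have hexp : ∀ x : ℝ, exp (x * I) * exp (-(x * I)) = 1 := by
    intro x; rw [← Complex.exp_add]; simp
  have hd : exp (κ.arg * I) = κ := by
    have := Complex.norm_mul_exp_arg_mul_I κ
    rwa [hκ, ofReal_one, one_mul] at this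
  set δ := κ.arg with hδ
  have d1 : -Real.pi < δ := Complex.neg_pi_lt_arg κ
  have d2 : δ < Real.pi := by
    refine lt_of_le_of_ne (Complex.arg_le_pi κ) (fun e => hκ1 ?_)
    rw [← hd, e, Complex.exp_pi_mul_I]
  have hck : conj κ = exp (-(δ * I)) := by
    rw [← hd, ← Complex.exp_conj]; simp
  have A1 := add_mem_Icc_of_sweep c1 c2 d1 d2 (by
    intro s r hs hr he
    refine h1 (1 / s) (ρ / r) (by positivity) (by positivity) ?_
    rw [arcPoint_sub_left hκ hκ1 hs, hWP]
    have h2' := one_add_mul_ne_zero (κ := conj κ) (by simpa using hκ)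
      (fun e => hκ1 (by simpa using congrArg conj e)) hs.le
    have hr0 : (r : ℂ) ≠ 0 := by exact_mod_cast hr.ne'
    have hce := congrArg conj he
    simp only [map_mul, map_add, map_one, conj_ofReal, ← Complex.exp_conj, conj_I] at hce
    rw [show (δ : ℂ) * -I = -(δ * I) by ring, ← hck, mul_neg] at hce
    congr 1
    push_cast
    rw [div_mul_eq_mul_div, div_eq_div_iff h2' hr0]
    linear_combination (-(ρ : ℂ) * a * exp (χ * I)) * hce
      + (ρ : ℂ) * a * (1 + s * conj κ) * hexp χ)
  have A2 := add_mem_Icc_of_sweep z1 z2 d1 d2 (by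
    intro s r hs hr he
    refine h2 s (ρ / r) hs (by positivity) ?_
    rw [arcPoint_sub_right hκ hκ1 hs, hWP, hbb]
    have h2' := one_add_mul_ne_zero hκ hκ1 hs.le
    have hr0 : (r : ℂ) ≠ 0 := by exact_mod_cast hr.ne'
    rw [hd] at he
    rw [sub_eq_add_neg]
    congr 1
    push_cast
    rw [div_mul_eq_mul_div, ← neg_div, div_eq_div_iff h2' hr0]
    linear_combination ((ρ : ℂ) * a * exp (χ * I)) * he)
  have A3 := add_mem_Icc_of_sweep (δ := ζ - Real.pi) c1 c2 (by linarith) (by linarith) (by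
    intro s r hs hr he
    refine h3 (ρ * r) (ρ * s) (by positivity) (by positivity) ?_
    have e1 : exp (((ζ - Real.pi : ℝ) : ℂ) * I) = - exp (ζ * I) := by
      push_cast
      rw [sub_mul, Complex.exp_sub, Complex.exp_pi_mul_I]; ring
    rw [e1] at he
    rw [hbb]
    push_cast
    linear_combination (-(ρ : ℂ) * a) * he - hWP)
  have hφe : φ = χ + δ := by
    refine angle_unique hφ hφ' A1.1 A1.2 (mul_right_cancel₀ ha0 ?_)
    rw [← dφ, c3]
    push_cast
    rw [add_mul, Complex.exp_add, hd]; ring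
  have hθe : θ = χ + (ζ - Real.pi) := by
    refine angle_unique hθ hθ' A3.1 A3.2 (mul_right_cancel₀ ha0 ?_)
    rw [← dθ, hbb]
    push_cast
    rw [add_mul, Complex.exp_add, sub_mul, Complex.exp_sub, Complex.exp_pi_mul_I]; ring
  have hψe : ψ = ζ + δ := by
    refine angle_unique hψ hψ' A2.1 A2.2 ?_
    have hPW' : (P - W) / ρ = -(a * exp (χ * I)) := by rw [← c3]; ring
    rw [hPW', hbb, hck] at dψ
    have hax : a * exp (χ * I) ≠ 0 := mul_ne_zero ha0 (Complex.exp_ne_zero _)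
    have h5 : exp (ζ * I) = exp (ψ * I) * exp (-(δ * I)) := by
      apply mul_left_cancel₀ hax
      linear_combination -dψ
    push_cast
    rw [add_mul, Complex.exp_add, h5]
    linear_combination (-exp (ψ * I)) * hexp δ
  constructor <;> linarith

namespace LombardiDrawing
variable {V : Type*} {G : SimpleGraph V} {D : LombardiDrawing G}

theorem IsPlanar.mem_of_mem_of_mem (hD : D.IsPlanar) {u v x y : V} (h : G.Adj u v)
    (h' : G.Adj x y) (hne : s(u, v) ≠ s(x, y)) {z : ℂ} (hz : z ∈ D.edgeSet u v)
    (hz' : z ∈ D.edgeSet x y) :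
    (z = D.pos u ∨ z = D.pos v) ∧ (z = D.pos x ∨ z = D.pos y) :=
  hD u v x y h h' hne ⟨hz, hz'⟩

/-- In a planar drawing of a triangle, the sum of two of the angles on one side exceeds the third
by more than `-π` and less than `3π`. -/
theorem IsPlanar.triangle_angles (hD : D.IsPlanar) {p q w : V} (hpq : G.Adj p q)
    (hqw : G.Adj q w) (hpw : G.Adj p w) {φ θ ψ : ℝ}
    (hφ : 0 < φ) (hφ' : φ < 2 * Real.pi) (hθ : 0 < θ) (hθ' : θ < 2 * Real.pi)
    (hψ : 0 < ψ) (hψ' : ψ < 2 * Real.pi)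
    (dφ : D.dir p w = exp (φ * I) * D.dir p q) (dθ : D.dir q p = exp (θ * I) * D.dir q w)
    (dψ : D.dir w q = exp (ψ * I) * D.dir w p) :
    -Real.pi < φ + θ - ψ ∧ φ + θ - ψ < 3 * Real.pi := by
  obtain ⟨κ, k1, k2, k3, k4, k5⟩ := arc_mem_edgeSet (D := D) (q := q) hpw hpq.ne hqw.ne'
  have hp := fun t (ht : 0 ≤ t) => ray_mem_edgeSet (D := D) hpq.symm (t := t) ht
  have hw := fun t (ht : 0 ≤ t) => ray_mem_edgeSet (D := D) hqw (t := t) ht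
  have hnq : ∀ {x : ℂ}, x ≠ 0 → D.pos q + x⁻¹ ≠ D.pos q := by
    intro x hx h; exact inv_ne_zero hx (by simpa using h)
  have hPW : D.inv q p ≠ D.inv q w := fun h =>
    hpw.ne (D.pos_injective (sub_left_injective (inv_injective h)))
  have hinv : ∀ v, D.pos q + (D.inv q v)⁻¹ = D.pos v := fun v => by
    rw [LombardiDrawing.inv, inv_inv, add_sub_cancel]
  have hpt : ∀ {x : ℂ} {v : V}, D.pos q + x⁻¹ = D.pos v → x = D.inv q v := by
    intro x v h
    rw [← hinv v] at h
    exact inv_injective (add_left_cancel h)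
  have hconj : ‖conj (D.dir q p)‖ = 1 ∧ ‖conj (D.dir q w)‖ = 1 := by
    simp only [RCLike.norm_conj]; exact ⟨norm_dir hpq.symm, norm_dir hqw⟩
  have hne0 : ∀ {u v : V}, G.Adj u v → D.dir u v ≠ 0 := fun h e => by
    simpa [e] using norm_dir (D := D) h
  refine angle_bounds_of_rays hPW hconj.1 hconj.2 k1 k2 ?_ ?_ ?_ hφ hφ' hθ hθ' hψ hψ' ?_ ?_ ?_
  · intro s t hs ht he
    obtain ⟨m1, m2⟩ := hD.mem_of_mem_of_mem hpw hpq.symm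
      (by simp [hpq.ne, hqw.ne']) (k3 s hs).2 (he ▸ (hp t ht).2)
    rcases m1 with m1 | m1
    · exact arcPoint_ne_left k1 k2 hPW hs (hpt m1)
    · exact arcPoint_ne_right k1 k2 hPW hs (hpt m1)
  · intro s t hs ht he
    obtain ⟨m1, m2⟩ := hD.mem_of_mem_of_mem hpw hqw
      (by simp [hpw.ne, hpq.ne, hqw.ne']) (k3 s hs).2 (he ▸ (hw t ht).2)
    rcases m1 with m1 | m1
    · exact arcPoint_ne_left k1 k2 hPW hs (hpt m1)
    · exact arcPoint_ne_right k1 k2 hPW hs (hpt m1)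
  · intro s t hs ht he
    obtain ⟨m1, m2⟩ := hD.mem_of_mem_of_mem hpq.symm hqw
      (by simp [hpw.ne, hpq.ne]) (hp s hs).2 (he ▸ (hw t ht).2)
    rcases m1 with m1 | m1
    · exact hnq (hp s hs).1 m1
    · rcases m2 with m2 | m2
      · exact hnq (hp s hs).1 m2
      · exact hpw.ne (D.pos_injective (m1.symm.trans m2))
  · have := k4 hpq.symm
    rw [dφ] at this
    apply mul_left_cancel₀ (hne0 hpq)
    linear_combination -this
  · have hexp : exp (θ * I) * exp (-(θ * I)) = 1 := by rw [← Complex.exp_add]; simp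
    have := congrArg conj dθ
    simp only [map_mul, ← Complex.exp_conj, conj_ofReal, conj_I, mul_neg] at this
    linear_combination (-exp (θ * I)) * this - conj (D.dir q w) * hexp
  · have := k5 hqw
    rw [dψ] at this
    apply mul_left_cancel₀ (hne0 hpw.symm)
    linear_combination this

end LombardiDrawing

/-! ### Unbounded curves made of two rays and an arc -/

/-- The curve that comes from infinity along the ray at `P` of direction `a`, follows the arc from
`P` to `W` and returns to infinity along the ray at `W` of direction `b`. -/
def rayArcRay (P W κ a b : ℂ) : Set ℂ :=
  {z | (∃ t : ℝ, 0 ≤ t ∧ z = P + t * a) ∨ (∃ s : ℝ, 0 < s ∧ z = arcPoint P W κ s) ∨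
    ∃ t : ℝ, 0 ≤ t ∧ z = W + t * b}

/-- The total angle through which a point running along `rayArcRay P W κ a b` turns as seen from
`z`, increased by `arg κ`. The principal arguments jump only where `z` lies on the curve. -/
noncomputable def sweptAngle (P W κ a b z : ℂ) : ℝ :=
  ((P - z) / a).arg + (κ * (W - z) / (P - z)).arg - ((W - z) / b).arg

theorem mem_slitPlane_of_forall_ne {x : ℂ} (h : ∀ t : ℝ, 0 ≤ t → x ≠ -t) : x ∈ slitPlane := by
  rw [mem_slitPlane_iff]
  by_contra! hc
  refine h (-x.re) (by linarith [hc.1]) ?_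
  apply Complex.ext <;> simp [hc.2]

theorem mem_slitPlane_of_notMem_rayArcRay {P W κ a b z : ℂ} (ha : ‖a‖ = 1) (hb : ‖b‖ = 1)
    (hκ : ‖κ‖ = 1) (hκ1 : κ ≠ -1) (hz : z ∉ rayArcRay P W κ a b) :
    (P - z) / a ∈ slitPlane ∧ κ * (W - z) / (P - z) ∈ slitPlane ∧ (W - z) / b ∈ slitPlane ∧
      P - z ≠ 0 ∧ W - z ≠ 0 := by
  have ha0 : a ≠ 0 := by rintro rfl; simp at ha
  have hb0 : b ≠ 0 := by rintro rfl; simp at hb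
  have hκ0 : κ ≠ 0 := by rintro rfl; simp at hκ
  simp only [rayArcRay, Set.mem_ofPred_eq, not_or, not_exists, not_and] at hz
  obtain ⟨z1, z2, z3⟩ := hz
  have hP : P - z ≠ 0 := by
    intro e; exact z1 0 le_rfl (by push_cast; linear_combination -e)
  have hW : W - z ≠ 0 := by
    intro e; exact z3 0 le_rfl (by push_cast; linear_combination -e)
  refine ⟨mem_slitPlane_of_forall_ne ?_, mem_slitPlane_of_forall_ne ?_,
    mem_slitPlane_of_forall_ne ?_, hP, hW⟩
  · intro t ht e
    rw [div_eq_iff ha0] at e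
    exact z1 t ht (by linear_combination -e)
  · intro t ht e
    rw [div_eq_iff hP] at e
    rcases ht.eq_or_lt with rfl | ht
    · exact mul_ne_zero hκ0 hW (by simpa using e)
    · refine z2 (1 / t) (by positivity) ?_
      have h := one_add_mul_ne_zero hκ hκ1 (one_div_pos.mpr ht).le
      have ht' : (t : ℂ) ≠ 0 := by exact_mod_cast ht.ne'
      have ht2 : ((1 / t : ℝ) : ℂ) * t = 1 := by push_cast; field_simp
      rw [arcPoint, eq_div_iff h]
      linear_combination (-((1 / t : ℝ) : ℂ)) * e + (P - z) * ht2
  · intro t ht e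
    rw [div_eq_iff hb0] at e
    exact z3 t ht (by linear_combination -e)

theorem continuousAt_sweptAngle {P W κ a b z : ℂ} (ha : ‖a‖ = 1) (hb : ‖b‖ = 1)
    (hκ : ‖κ‖ = 1) (hκ1 : κ ≠ -1) (hz : z ∉ rayArcRay P W κ a b) :
    ContinuousAt (sweptAngle P W κ a b) z := by
  obtain ⟨h1, h2, h3, hP, hW⟩ := mem_slitPlane_of_notMem_rayArcRay ha hb hκ hκ1 hz
  have c1 : ContinuousAt (fun z => (P - z) / a) z := by fun_prop
  have c2 : ContinuousAt (fun z => κ * (W - z) / (P - z)) z :=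
    ContinuousAt.div (by fun_prop) (by fun_prop) hP
  have c3 : ContinuousAt (fun z => (W - z) / b) z := by fun_prop
  exact ((ContinuousAt.comp (f := fun z => (P - z) / a) (continuousAt_arg h1) c1).add
    (ContinuousAt.comp (f := fun z => κ * (W - z) / (P - z)) (continuousAt_arg h2) c2)).sub
    (ContinuousAt.comp (f := fun z => (W - z) / b) (continuousAt_arg h3) c3)

theorem exp_arg_mul_I {x : ℂ} (hx : x ≠ 0) : exp (x.arg * I) = x / ‖x‖ := by
  have h : (‖x‖ : ℂ) ≠ 0 := by exact_mod_cast norm_ne_zero_iff.mpr hx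
  rw [eq_div_iff h, mul_comm, Complex.norm_mul_exp_arg_mul_I]

theorem exp_sweptAngle {P W κ a b z : ℂ} (ha : ‖a‖ = 1) (hb : ‖b‖ = 1)
    (hκ : ‖κ‖ = 1) (hκ1 : κ ≠ -1) (hz : z ∉ rayArcRay P W κ a b) :
    exp (sweptAngle P W κ a b z * I) = κ * b / a := by
  obtain ⟨h1, h2, h3, hP, hW⟩ := mem_slitPlane_of_notMem_rayArcRay ha hb hκ hκ1 hz
  have ha0 : a ≠ 0 := by rintro rfl; simp at ha
  have hb0 : b ≠ 0 := by rintro rfl; simp at hb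
  have hP' : (‖P - z‖ : ℂ) ≠ 0 := by exact_mod_cast norm_ne_zero_iff.mpr hP
  have hW' : (‖W - z‖ : ℂ) ≠ 0 := by exact_mod_cast norm_ne_zero_iff.mpr hW
  rw [sweptAngle]
  push_cast
  rw [sub_mul, add_mul, Complex.exp_sub, Complex.exp_add, exp_arg_mul_I (slitPlane_ne_zero h1),
    exp_arg_mul_I (slitPlane_ne_zero h2), exp_arg_mul_I (slitPlane_ne_zero h3)]
  simp only [norm_div, norm_mul, ha, hb, hκ]
  push_cast
  field_simp

/-- A continuous real function whose exponential `e^{ig}` is constant is itself constant on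
connected sets. -/
theorem eq_of_exp_eq {g : ℝ → ℝ} {S : Set ℝ} (hS : IsPreconnected S) (hg : ContinuousOn g S)
    {c : ℂ} (hc : ∀ x ∈ S, exp (g x * I) = c) {x y : ℝ} (hx : x ∈ S) (hy : y ∈ S) :
    g x = g y := by
  wlog hlt : g x < g y generalizing x y
  · rcases lt_trichotomy (g x) (g y) with h | h | h
    · exact this hx hy h
    · exact h
    · exact (this hy hx h).symm
  exfalso
  obtain ⟨n, hn⟩ := Complex.exp_eq_exp_iff_exists_int.mp ((hc y hy).trans (hc x hx).symm)
  have h1 : ((g y : ℝ) : ℂ) = g x + n * (2 * Real.pi) := by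
    apply mul_right_cancel₀ I_ne_zero
    linear_combination hn
  have h2 : g y = g x + n * (2 * Real.pi) := by exact_mod_cast h1
  have hp := Real.pi_pos
  have h3 : (1 : ℝ) ≤ n := by
    have : 0 < n := by
      by_contra! hc
      have : (n : ℝ) ≤ 0 := by exact_mod_cast hc
      nlinarith
    exact_mod_cast this
  obtain ⟨z, hz, he⟩ := hS.intermediate_value hx hy hg
    (show g x + Real.pi ∈ Set.Icc (g x) (g y) from ⟨by linarith, by nlinarith⟩)
  have h4 := hc z hz
  rw [he, ← hc x hx] at h4
  push_cast at h4
  rw [add_mul, Complex.exp_add, Complex.exp_pi_mul_I] at h4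
  exact Complex.exp_ne_zero (g x * I) (by linear_combination (-1 / 2 : ℂ) * h4)

/-- The swept angle is determined modulo `2π` off the curve, hence constant along every path that
avoids the curve. -/
theorem sweptAngle_comp_eq {P W κ a b : ℂ} (ha : ‖a‖ = 1) (hb : ‖b‖ = 1)
    (hκ : ‖κ‖ = 1) (hκ1 : κ ≠ -1) {f : ℝ → ℂ} {S : Set ℝ} (hS : IsPreconnected S)
    (hf : ContinuousOn f S) (hfK : ∀ x ∈ S, f x ∉ rayArcRay P W κ a b) {x y : ℝ}
    (hx : x ∈ S) (hy : y ∈ S) :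
    sweptAngle P W κ a b (f x) = sweptAngle P W κ a b (f y) :=
  eq_of_exp_eq (g := fun x => sweptAngle P W κ a b (f x)) hS
    (fun x hx => (continuousAt_sweptAngle ha hb hκ hκ1 (hfK x hx)).comp_continuousWithinAt
      (hf x hx)) (fun x hx => exp_sweptAngle ha hb hκ hκ1 (hfK x hx)) hx hy

theorem neg_div_mem_slitPlane {a c : ℂ} (ha : ‖a‖ = 1) (hc : ‖c‖ = 1) (hca : c ≠ a) :
    -c / a ∈ slitPlane := by
  have ha0 : a ≠ 0 := by rintro rfl; simp at ha
  refine mem_slitPlane_of_forall_ne fun t ht e => hca ?_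
  rw [div_eq_iff ha0] at e
  have h2 := congrArg norm e
  rw [norm_neg, hc, norm_mul, ha, norm_neg, norm_real, Real.norm_of_nonneg ht, mul_one] at h2
  rw [← h2] at e
  push_cast at e
  linear_combination -e

open Filter Topology in
theorem tendsto_sweptAngle {P W κ a b C c : ℂ} (ha : ‖a‖ = 1) (hb : ‖b‖ = 1) (hc : ‖c‖ = 1)
    (hκ : ‖κ‖ = 1) (hκ1 : κ ≠ -1) (hca : c ≠ a) (hcb : c ≠ b) :
    Tendsto (fun t : ℝ => sweptAngle P W κ a b (C + t * c)) atTop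
      (𝓝 ((-c / a).arg + κ.arg - (-c / b).arg)) := by
  have hc0 : c ≠ 0 := by rintro rfl; simp at hc
  have hlim : ∀ A : ℂ, Tendsto (fun t : ℝ => (A - C) * ((t⁻¹ : ℝ) : ℂ) - c) atTop (𝓝 (-c)) := by
    intro A
    have h0 : Tendsto (fun t : ℝ => ((t⁻¹ : ℝ) : ℂ)) atTop (𝓝 ((0 : ℝ) : ℂ)) :=
      (continuous_ofReal.tendsto 0).comp tendsto_inv_atTop_zero
    simpa using (h0.const_mul (A - C)).sub_const c
  have hresc : ∀ A : ℂ, ∀ t : ℝ, 0 < t →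
      A - (C + t * c) = t * ((A - C) * ((t⁻¹ : ℝ) : ℂ) - c) := by
    intro A t ht
    have ht' : (t : ℂ) ≠ 0 := by exact_mod_cast ht.ne'
    push_cast
    field_simp
    ring
  have hk : κ ∈ slitPlane := by
    have := neg_div_mem_slitPlane (a := -1) (by simp) hκ hκ1
    simpa using this
  have t1 : Tendsto (fun t : ℝ => ((P - (C + t * c)) / a).arg) atTop (𝓝 (-c / a).arg) := by
    refine (((continuousAt_arg (neg_div_mem_slitPlane ha hc hca)).tendsto).comp
      ((hlim P).div_const a)).congr' ?_
    filter_upwards [eventually_gt_atTop 0] with t ht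
    rw [hresc P t ht, mul_div_assoc, Complex.arg_real_mul _ ht]; rfl
  have t3 : Tendsto (fun t : ℝ => ((W - (C + t * c)) / b).arg) atTop (𝓝 (-c / b).arg) := by
    refine (((continuousAt_arg (neg_div_mem_slitPlane hb hc hcb)).tendsto).comp
      ((hlim W).div_const b)).congr' ?_
    filter_upwards [eventually_gt_atTop 0] with t ht
    rw [hresc W t ht, mul_div_assoc, Complex.arg_real_mul _ ht]; rfl
  have t2 : Tendsto (fun t : ℝ => (κ * (W - (C + t * c)) / (P - (C + t * c))).arg) atTop
      (𝓝 κ.arg) := by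
    have hl : Tendsto (fun t : ℝ => κ * ((W - C) * ((t⁻¹ : ℝ) : ℂ) - c) /
        ((P - C) * ((t⁻¹ : ℝ) : ℂ) - c)) atTop (𝓝 κ) := by
      have := ((hlim W).const_mul κ).div (hlim P) (neg_ne_zero.mpr hc0)
      rwa [mul_div_assoc, div_self (neg_ne_zero.mpr hc0), mul_one] at this
    refine (((continuousAt_arg hk).tendsto).comp hl).congr' ?_
    filter_upwards [eventually_gt_atTop 0] with t ht
    have ht' : (t : ℂ) ≠ 0 := by exact_mod_cast ht.ne'
    rw [hresc W t ht, hresc P t ht, mul_left_comm, mul_div_mul_left _ _ ht']; rfl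
  exact (t1.add t2).sub t3

/-- Along a ray that avoids the curve the swept angle keeps the value it has at infinity. -/
theorem sweptAngle_ray {P W κ a b C c : ℂ} (ha : ‖a‖ = 1) (hb : ‖b‖ = 1) (hc : ‖c‖ = 1)
    (hκ : ‖κ‖ = 1) (hκ1 : κ ≠ -1) (hca : c ≠ a) (hcb : c ≠ b)
    (h : ∀ t : ℝ, 0 ≤ t → C + t * c ∉ rayArcRay P W κ a b) :
    sweptAngle P W κ a b C = (-c / a).arg + κ.arg - (-c / b).arg := by
  refine tendsto_nhds_unique (Filter.Tendsto.congr' ?_ tendsto_const_nhds)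
    (tendsto_sweptAngle (P := P) (W := W) (C := C) ha hb hc hκ hκ1 hca hcb)
  filter_upwards [Filter.eventually_ge_atTop 0] with t ht
  have := sweptAngle_comp_eq (x := 0) (y := t) ha hb hκ hκ1 isPreconnected_Ici
    (f := fun t : ℝ => C + t * c) (by fun_prop) h (Set.mem_Ici.mpr le_rfl) ht
  simpa using this

theorem sweptAngle_arc {P W κ a b C E μ c e : ℂ} (ha : ‖a‖ = 1) (hb : ‖b‖ = 1)
    (hκ : ‖κ‖ = 1) (hκ1 : κ ≠ -1) (hμ : ‖μ‖ = 1) (hμ1 : μ ≠ -1)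
    (h : ∀ z ∈ rayArcRay C E μ c e, z ∉ rayArcRay P W κ a b) :
    sweptAngle P W κ a b C = sweptAngle P W κ a b E := by
  have hμ0 : μ ≠ 0 := by rintro rfl; simp at hμ
  -- the arc from `C` to `E` in the parameter `s / (1 - s)`, which extends to both end points
  set f : ℝ → ℂ := fun s => (((1 - s : ℝ) : ℂ) * C + s * μ * E) / (((1 - s : ℝ) : ℂ) + s * μ)
    with hf
  have hresc : ∀ s : ℝ, s < 1 → ((1 - s : ℝ) : ℂ) ≠ 0 ∧
      ((1 - s : ℝ) : ℂ) + s * μ = ((1 - s : ℝ) : ℂ) * (1 + ((s / (1 - s) : ℝ) : ℂ) * μ) := by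
    intro s hs
    have h1 : ((1 - s : ℝ) : ℂ) ≠ 0 := by exact_mod_cast (by linarith : (1 - s : ℝ) ≠ 0)
    refine ⟨h1, ?_⟩
    push_cast at h1 ⊢
    field_simp
  have hden : ∀ s ∈ Set.Icc (0 : ℝ) 1, ((1 - s : ℝ) : ℂ) + s * μ ≠ 0 := by
    rintro s ⟨h0, h1⟩
    rcases h1.eq_or_lt with rfl | h1
    · simpa using hμ0
    · obtain ⟨h2, h3⟩ := hresc s h1
      rw [h3]
      exact mul_ne_zero h2 (one_add_mul_ne_zero hμ hμ1 (div_nonneg h0 (by linarith)))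
  have hmem : ∀ s ∈ Set.Icc (0 : ℝ) 1, f s ∈ rayArcRay C E μ c e := by
    rintro s ⟨h0, h1⟩
    rcases h0.eq_or_lt with rfl | h0
    · exact Or.inl ⟨0, le_rfl, by simp [hf]⟩
    rcases h1.eq_or_lt with rfl | h1
    · exact Or.inr (Or.inr ⟨0, le_rfl, by simp [hf, hμ0]⟩)
    refine Or.inr (Or.inl ⟨s / (1 - s), div_pos h0 (by linarith), ?_⟩)
    obtain ⟨h2, h3⟩ := hresc s h1
    rw [hf, arcPoint]
    simp only
    rw [h3, ← mul_div_mul_left (C + _) _ h2]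
    congr 1
    push_cast at h2 ⊢
    field_simp
  have := sweptAngle_comp_eq (x := 0) (y := 1) ha hb hκ hκ1 isPreconnected_Icc (f := f)
    (ContinuousOn.div (by fun_prop) (by fun_prop) hden) (fun s hs => h _ (hmem s hs))
    (by simp) (by simp)
  simpa [hf, hμ0] using this

/-- Two disjoint curves of the form `rayArcRay` do not interlace at infinity. -/
theorem lt_iff_lt_of_disjoint {P W κ a b C E μ c e : ℂ} (ha : ‖a‖ = 1)
    (hκ : ‖κ‖ = 1) (hκ1 : κ ≠ -1) (hμ : ‖μ‖ = 1) (hμ1 : μ ≠ -1)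
    (h : ∀ z ∈ rayArcRay C E μ c e, z ∉ rayArcRay P W κ a b)
    {x x' y : ℝ} (hx : 0 < x) (hx2 : x < 2 * Real.pi) (hx' : 0 < x') (hx2' : x' < 2 * Real.pi)
    (hy : 0 < y) (hy2 : y < 2 * Real.pi) (hxy : x ≠ y) (hxy' : x' ≠ y)
    (hb : b = exp (y * I) * a) (hc : c = exp (x * I) * a) (he : e = exp (x' * I) * a) :
    x < y ↔ x' < y := by
  have ha0 : a ≠ 0 := by rintro rfl; simp at ha
  have nb : ‖b‖ = 1 := by rw [hb, norm_mul, Complex.norm_exp_ofReal_mul_I, ha, one_mul]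
  -- the value of the swept angle at the end of a ray whose direction is at the angle `x`
  have key : ∀ {x : ℝ} {C c : ℂ}, 0 < x → x < 2 * Real.pi → x ≠ y → c = exp (x * I) * a →
      (∀ t : ℝ, 0 ≤ t → C + t * c ∉ rayArcRay P W κ a b) →
      sweptAngle P W κ a b C = κ.arg + if x < y then y - 2 * Real.pi else y := by
    intro x C c hx hx2 hxy hc hray
    have nc : ‖c‖ = 1 := by rw [hc, norm_mul, Complex.norm_exp_ofReal_mul_I, ha, one_mul]
    have hca : c ≠ a := by
      intro e
      have h1 : exp (x * I) = exp ((0 : ℝ) * I) := by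
        apply mul_right_cancel₀ ha0
        rw [← hc, e]; simp
      exact hx.ne' (angle_unique hx hx2 le_rfl (by positivity) h1)
    have hcb : c ≠ b := by
      intro e
      rw [hc, hb] at e
      exact hxy (angle_unique hx hx2 hy.le hy2.le (mul_right_cancel₀ ha0 e))
    rw [sweptAngle_ray ha nb nc hκ hκ1 hca hcb hray]
    have e1 : -c / a = exp (((x - Real.pi : ℝ) : ℂ) * I) := by
      rw [hc]; push_cast; rw [sub_mul, Complex.exp_sub, Complex.exp_pi_mul_I]; field_simp
    have a1 : (-c / a).arg = x - Real.pi := by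
      rw [e1, Complex.arg_exp_mul_I, toIocMod_eq_self]
      constructor <;> linarith
    have a2 : (-c / b).arg = x - y - Real.pi + if x < y then 2 * Real.pi else 0 := by
      have e2 : -c / b = exp (((x - y - Real.pi + if x < y then 2 * Real.pi else 0 : ℝ) : ℂ) * I) := by
        rw [hc, hb]
        have e3 : exp (((x - y - Real.pi + if x < y then 2 * Real.pi else 0 : ℝ) : ℂ) * I)
            = exp (((x - y - Real.pi : ℝ) : ℂ) * I) := by
          split_ifs
          · push_cast; rw [add_mul, Complex.exp_add, Complex.exp_two_pi_mul_I, mul_one]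
          · simp
        rw [e3]
        push_cast
        rw [sub_mul, sub_mul, Complex.exp_sub, Complex.exp_sub, Complex.exp_pi_mul_I]
        field_simp
      rw [e2, Complex.arg_exp_mul_I, toIocMod_eq_self]
      rcases lt_or_gt_of_ne hxy with h1 | h1
      · rw [if_pos h1]; constructor <;> linarith
      · rw [if_neg h1.not_gt]; constructor <;> linarith
    rw [a1, a2]
    split_ifs <;> ring
  have h1 := key hx hx2 hxy hc (fun t ht => h _ (Or.inl ⟨t, ht, rfl⟩))
  have h2 := key hx' hx2' hxy' he (fun t ht => h _ (Or.inr (Or.inr ⟨t, ht, rfl⟩)))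
  rw [sweptAngle_arc ha nb hκ hκ1 hμ hμ1 h, h2] at h1
  have hp := Real.pi_pos
  split_ifs at h1 with h3 h4 h4
  · exact ⟨fun _ => h3, fun _ => h4⟩
  · linarith
  · linarith
  · exact ⟨fun h => absurd h h4, fun h => absurd h h3⟩

/-! ### Rotations at the vertices of a planar Lombardi drawing -/

/-- Along a chain of related elements a predicate that the relation preserves both ways is
constant. -/
theorem iff_of_isChain {α : Type*} {R : α → α → Prop} {p : α → Prop} {l : List α}
    (h : l.IsChain R) (hp : ∀ x ∈ l, ∀ y ∈ l, R x y → (p x ↔ p y)) :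
    ∀ x ∈ l, ∀ y ∈ l, (p x ↔ p y) := by
  induction l with
  | nil => simp
  | cons a l ih =>
    have ih' := ih h.tail (fun x hx y hy => hp x (by simp [hx]) y (by simp [hy]))
    have ha : ∀ y ∈ l, (p a ↔ p y) := by
      intro y hy
      cases l with
      | nil => simp at hy
      | cons b l =>
        have hab : R a b := by
          rw [List.isChain_cons_cons] at h; exact h.1
        exact (hp a (by simp) b (by simp) hab).trans (ih' b (by simp) y hy)
    intro x hx y hy
    rcases List.mem_cons.mp hx with hxa | hxl <;> rcases List.mem_cons.mp hy with hya | hyl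
    · rw [hxa, hya]
    · rw [hxa]; exact ha y hyl
    · rw [hya]; exact (ha x hxl).symm
    · exact ih' x hxl y hyl

namespace LombardiDrawing
variable {V : Type*} {G : SimpleGraph V} {D : LombardiDrawing G}

theorem dir_ne_zero {u v : V} (h : G.Adj u v) : D.dir u v ≠ 0 := fun e => by
  simpa [e] using norm_dir (D := D) h

variable (D) in
/-- Perfect angular resolution, with the positions of the neighbours of `v` given as natural
numbers below the degree. -/
theorem exists_position (v : V) : ∃ (ψ : ℝ) (σ : V → ℕ),
    (∀ w, G.Adj v w → σ w < (G.neighborSet v).ncard ∧ D.dir v w =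
      exp (((ψ + 2 * Real.pi * (σ w : ℝ) / (G.neighborSet v).ncard : ℝ) : ℂ) * I)) ∧
    (∀ b c, G.Adj v b → G.Adj v c → σ b = σ c → b = c) ∧
    ∀ k < (G.neighborSet v).ncard, ∃ w, G.Adj v w ∧ σ w = k := by
  classical
  obtain ⟨ψ, σ, hσ⟩ := D.perfect_resolution v
  refine ⟨ψ, fun w => if h : G.Adj v w then (σ ⟨w, h⟩ : ℕ) else 0, ?_, ?_, ?_⟩
  · intro w h
    simp only [dif_pos h]
    exact ⟨(σ ⟨w, h⟩).2, hσ ⟨w, h⟩⟩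
  · intro b c hb hc h
    simp only [dif_pos hb, dif_pos hc] at h
    exact congrArg Subtype.val (σ.injective (Fin.ext h))
  · intro k hk
    have h : G.Adj v (σ.symm ⟨k, hk⟩) := (σ.symm ⟨k, hk⟩).2
    refine ⟨σ.symm ⟨k, hk⟩, h, ?_⟩
    simp only [dif_pos h]
    exact congrArg Fin.val (σ.apply_symm_apply ⟨k, hk⟩)

/-- Two edges at `v` form a non-zero multiple of `2π / deg v`, below a full turn. -/
theorem exists_dir_eq_of_ne {v b c : V} (hb : G.Adj v b) (hc : G.Adj v c) (hbc : b ≠ c) :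
    ∃ j : ℕ, 0 < j ∧ j < (G.neighborSet v).ncard ∧
      D.dir v c = exp (((2 * Real.pi * j / (G.neighborSet v).ncard : ℝ) : ℂ) * I) * D.dir v b := by
  obtain ⟨ψ, σ, hσ, hinj, -⟩ := D.exists_position v
  obtain ⟨lb, hB⟩ := hσ b hb
  obtain ⟨lc, hC⟩ := hσ c hc
  have hne : σ b ≠ σ c := fun e => hbc (hinj b c hb hc e)
  rw [hB, hC]
  generalize (G.neighborSet v).ncard = d at *
  generalize σ b = i at *
  generalize σ c = k at *
  have hd0 : (d : ℂ) ≠ 0 := by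
    have : d ≠ 0 := by omega
    exact_mod_cast this
  rcases lt_or_gt_of_ne hne with h | h
  · refine ⟨k - i, by omega, by omega, ?_⟩
    rw [← Complex.exp_add]
    congr 1
    push_cast [Nat.cast_sub h.le]
    ring
  · refine ⟨k + d - i, by omega, by omega, ?_⟩
    rw [← Complex.exp_add, ← mul_one (exp (((ψ + 2 * Real.pi * k / d : ℝ) : ℂ) * I)),
      ← Complex.exp_two_pi_mul_I, ← Complex.exp_add]
    congr 1
    push_cast [Nat.cast_sub (show i ≤ k + d by omega)]
    field_simp
    ring

theorem angle_mem_Ioo {j d : ℕ} (h0 : 0 < j) (hd : j < d) :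
    0 < 2 * Real.pi * j / d ∧ 2 * Real.pi * j / d < 2 * Real.pi := by
  have h1 : (0 : ℝ) < j := by exact_mod_cast h0
  have h2 : (j : ℝ) < d := by exact_mod_cast hd
  have h3 : (0 : ℝ) < d := h1.trans h2
  have hp := Real.pi_pos
  exact ⟨by positivity, by rw [div_lt_iff₀ h3]; nlinarith⟩

theorem dir_ne_dir {v b c : V} (hb : G.Adj v b) (hc : G.Adj v c) (hbc : b ≠ c) :
    D.dir v b ≠ D.dir v c := by
  obtain ⟨j, h0, h1, h⟩ := exists_dir_eq_of_ne (D := D) hb hc hbc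
  obtain ⟨a1, a2⟩ := angle_mem_Ioo h0 h1
  intro e
  apply exp_angle_ne_one a1 a2
  apply mul_right_cancel₀ (dir_ne_zero (D := D) hb)
  rw [← h, one_mul, e]

theorem exists_dir_eq {v b : V} (hb : G.Adj v b) {j : ℕ} (hj : j < (G.neighborSet v).ncard) :
    ∃ c, G.Adj v c ∧
      D.dir v c = exp (((2 * Real.pi * j / (G.neighborSet v).ncard : ℝ) : ℂ) * I) * D.dir v b := by
  obtain ⟨ψ, σ, hσ, -, hsurj⟩ := D.exists_position v
  obtain ⟨lb, hB⟩ := hσ b hb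
  have hd0 : ((G.neighborSet v).ncard : ℂ) ≠ 0 := by
    have : (G.neighborSet v).ncard ≠ 0 := by omega
    exact_mod_cast this
  rw [hB]
  by_cases h : σ b + j < (G.neighborSet v).ncard
  · obtain ⟨c, hc, h1⟩ := hsurj _ h
    refine ⟨c, hc, ?_⟩
    rw [(hσ c hc).2, h1, ← Complex.exp_add]
    congr 1
    push_cast
    ring
  · obtain ⟨c, hc, h1⟩ := hsurj (σ b + j - (G.neighborSet v).ncard) (by omega)
    refine ⟨c, hc, ?_⟩
    rw [(hσ c hc).2, h1, ← Complex.exp_add,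
      ← mul_one (exp (((ψ + 2 * Real.pi * _ / _ : ℝ) : ℂ) * I)),
      ← Complex.exp_two_pi_mul_I, ← Complex.exp_add]
    congr 1
    push_cast [Nat.cast_sub (show (G.neighborSet v).ncard ≤ σ b + j by omega)]
    field_simp
    ring

/-- The triangle `q u w`, inverted at `q`, is a curve made of two rays and an arc. -/
theorem exists_mem_edgeSet_of_mem_rayArcRay {q u w : V} {κ z : ℂ} (hu : G.Adj q u)
    (hw : G.Adj q w) (huw : G.Adj u w)
    (hκ : ∀ s : ℝ, 0 < s → arcPoint (D.inv q u) (D.inv q w) κ s ≠ 0 ∧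
        D.pos q + (arcPoint (D.inv q u) (D.inv q w) κ s)⁻¹ ∈ D.edgeSet u w)
    (hz : z ∈ rayArcRay (D.inv q u) (D.inv q w) κ (conj (D.dir q u)) (conj (D.dir q w))) :
    z ≠ 0 ∧ ∃ i j, G.Adj i j ∧ (i = q ∨ i = u ∨ i = w) ∧ (j = u ∨ j = w) ∧
      D.pos q + z⁻¹ ∈ D.edgeSet i j := by
  rcases hz with ⟨t, ht, rfl⟩ | ⟨s, hs, rfl⟩ | ⟨t, ht, rfl⟩
  · obtain ⟨h1, h2⟩ := ray_mem_edgeSet (D := D) hu ht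
    exact ⟨h1, q, u, hu, by simp, by simp, h2⟩
  · obtain ⟨h1, h2⟩ := hκ s hs
    exact ⟨h1, u, w, huw, by simp, by simp, h2⟩
  · obtain ⟨h1, h2⟩ := ray_mem_edgeSet (D := D) hw ht
    exact ⟨h1, q, w, hw, by simp, by simp, h2⟩

/-- Two triangles `v c e` and `v b d` that share just the vertex `v` meet nowhere else. -/
theorem IsPlanar.eq_of_mem_triangles (hD : D.IsPlanar) {v b d c e i j i' j' : V}
    (hc : c ≠ v) (he : e ≠ v) (hcb : c ≠ b) (hcd : c ≠ d) (heb : e ≠ b) (hed : e ≠ d)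
    (hij : G.Adj i j) (hij' : G.Adj i' j') (hi : i = v ∨ i = c ∨ i = e) (hj : j = c ∨ j = e)
    (hi' : i' = v ∨ i' = b ∨ i' = d) (hj' : j' = b ∨ j' = d) {z : ℂ} (hz : z ∈ D.edgeSet i j)
    (hz' : z ∈ D.edgeSet i' j') : z = D.pos v := by
  have hjj : j ≠ i' ∧ j ≠ j' := by
    constructor
    · rintro rfl; clear hij hij' hi hj' hz hz'; grind
    · rintro rfl; clear hij hij' hi hi' hz hz'; grind
  have hij2 : (i = j' → i = v) ∧ (i = i' → i = v) := by
    clear hij hij' hz hz'; grind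
  obtain ⟨p1, p2⟩ := hD.mem_of_mem_of_mem hij hij' (by
    intro h
    rcases Sym2.mem_iff.mp (h ▸ Sym2.mem_mk_right i j : j ∈ s(i', j')) with h | h
    · exact hjj.1 h
    · exact hjj.2 h) hz hz'
  rcases p1 with p | p <;> rcases p2 with p' | p'
  · rw [p, hij2.2 (D.pos_injective (p.symm.trans p'))]
  · rw [p, hij2.1 (D.pos_injective (p.symm.trans p'))]
  · exact absurd (D.pos_injective (p.symm.trans p')) hjj.1
  · exact absurd (D.pos_injective (p.symm.trans p')) hjj.2

/-- Two triangles of a planar drawing that share just the vertex `v` do not interlace at `v`: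
both edges `vc` and `ve` lie in the same sector bounded by `vb` and `vd`. -/
theorem IsPlanar.lt_iff_lt (hD : D.IsPlanar) {v b d c e : V} (hb : G.Adj v b) (hd : G.Adj v d)
    (hc : G.Adj v c) (he : G.Adj v e) (hbd : G.Adj b d) (hce : G.Adj c e) (hcb : c ≠ b)
    (hcd : c ≠ d) (heb : e ≠ b) (hed : e ≠ d) {x x' y : ℝ}
    (hx : 0 < x) (hx2 : x < 2 * Real.pi) (hx' : 0 < x') (hx2' : x' < 2 * Real.pi)
    (hy : 0 < y) (hy2 : y < 2 * Real.pi) (dd : D.dir v d = exp (y * I) * D.dir v b)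
    (dc : D.dir v c = exp (x * I) * D.dir v b) (de : D.dir v e = exp (x' * I) * D.dir v b) :
    x < y ↔ x' < y := by
  have hconj : ∀ {w : V} {x : ℝ}, D.dir v w = exp (x * I) * D.dir v b →
      conj (D.dir v w) = exp (((2 * Real.pi - x : ℝ) : ℂ) * I) * conj (D.dir v b) := by
    intro w x h
    rw [h, map_mul, ← Complex.exp_conj]
    push_cast
    rw [sub_mul, Complex.exp_sub, Complex.exp_two_pi_mul_I, map_mul, conj_ofReal, conj_I, mul_neg,
      Complex.exp_neg, one_div]
  have hxy : x ≠ y := by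
    rintro rfl; exact dir_ne_dir hc hd hcd (dc.trans dd.symm)
  have hxy' : x' ≠ y := by
    rintro rfl; exact dir_ne_dir he hd hed (de.trans dd.symm)
  obtain ⟨κ, k1, k2, k3, -, -⟩ := arc_mem_edgeSet (D := D) (q := v) hbd hb.ne' hd.ne'
  obtain ⟨μ, m1, m2, m3, -, -⟩ := arc_mem_edgeSet (D := D) (q := v) hce hc.ne' he.ne'
  have key := lt_iff_lt_of_disjoint (P := D.inv v b) (W := D.inv v d) (C := D.inv v c)
    (E := D.inv v e) (by rw [RCLike.norm_conj]; exact norm_dir hb) k1 k2 m1 m2 (by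
      intro z hz hz'
      obtain ⟨z0, i, j, hij, hi, hj, hm⟩ := exists_mem_edgeSet_of_mem_rayArcRay hc he hce m3 hz
      obtain ⟨-, i', j', hij', hi', hj', hm'⟩ :=
        exists_mem_edgeSet_of_mem_rayArcRay hb hd hbd k3 hz'
      have hpos := hD.eq_of_mem_triangles hc.ne' he.ne' hcb hcd heb hed hij hij' hi hj hi' hj'
        hm hm'
      exact inv_ne_zero z0 (by simpa using hpos))
    (x := 2 * Real.pi - x) (x' := 2 * Real.pi - x') (y := 2 * Real.pi - y)
    (by linarith) (by linarith) (by linarith) (by linarith) (by linarith) (by linarith)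
    (by intro h; exact hxy (by linarith)) (by intro h; exact hxy' (by linarith))
    (hconj dd) (hconj dc) (hconj de)
  constructor
  · intro h
    by_contra! h'
    have := key.mpr (by have := lt_of_le_of_ne h' hxy'.symm; linarith)
    linarith
  · intro h
    by_contra! h'
    have := key.mp (by have := lt_of_le_of_ne h' hxy.symm; linarith)
    linarith

/-- The unit complex number of angle `2π / deg v`, by which multiplication takes the direction of
each edge at `v` to that of the next one. The degree is the `ncard` of the neighbour set. -/
noncomputable def rot (G : SimpleGraph V) (v : V) : ℂ :=
  exp (((2 * Real.pi / (G.neighborSet v).ncard : ℝ) : ℂ) * I)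

/-- If the neighbours of `v` other than the two adjacent ones `b` and `c` are linked by a path in
`G`, then `vb` and `vc` are consecutive in the rotation at `v`: the path stays in one of the two
sectors between `vb` and `vc`, so that the other sector is empty. -/
theorem IsPlanar.consecutive (hD : D.IsPlanar) {v b c : V} (hb : G.Adj v b) (hc : G.Adj v c)
    (hbc : G.Adj b c) (l : List V) (hl : l.IsChain G.Adj)
    (hl1 : ∀ x ∈ l, G.Adj v x ∧ x ≠ b ∧ x ≠ c)
    (hl2 : ∀ x, G.Adj v x → x = b ∨ x = c ∨ x ∈ l) :
    D.dir v c = rot G v * D.dir v b ∨ D.dir v b = rot G v * D.dir v c := by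
  obtain ⟨j, j0, jd, hj⟩ := exists_dir_eq_of_ne (D := D) hb hc hbc.ne
  obtain ⟨a1, a2⟩ := angle_mem_Ioo j0 jd
  rw [rot]
  set d := (G.neighborSet v).ncard with hd
  have hd0 : (0 : ℝ) < d := by
    have : 0 < d := by omega
    exact_mod_cast this
  have hd0' : (d : ℂ) ≠ 0 := by exact_mod_cast hd0.ne'
  have hp := Real.pi_pos
  by_cases e1 : j = 1
  · left; rw [hj, e1]; simp
  by_cases e2 : j + 1 = d
  · right
    rw [hj, ← mul_assoc, ← Complex.exp_add]
    have : ((2 * Real.pi / d : ℝ) : ℂ) * I + ((2 * Real.pi * j / d : ℝ) : ℂ) * I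
        = 2 * Real.pi * I := by
      have : (d : ℂ) = j + 1 := by rw [← e2]; push_cast; ring
      rw [this] at hd0'
      push_cast
      rw [this]
      field_simp
      ring
    rw [this, Complex.exp_two_pi_mul_I, one_mul]
  exfalso
  have hmem : ∀ i : ℕ, 0 < i → i < d → i ≠ j → ∃ x ∈ l,
      D.dir v x = exp (((2 * Real.pi * i / d : ℝ) : ℂ) * I) * D.dir v b := by
    intro i i0 id ij
    obtain ⟨x, hx, hxd⟩ := exists_dir_eq (D := D) hb id
    rw [← hd] at hxd
    obtain ⟨b1, b2⟩ := angle_mem_Ioo i0 id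
    rcases hl2 x hx with rfl | rfl | h
    · exfalso
      apply exp_angle_ne_one b1 b2
      apply mul_right_cancel₀ (dir_ne_zero (D := D) hx)
      rw [← hxd, one_mul]
    · exfalso
      rw [hj] at hxd
      have h1 := angle_unique a1 a2 b1.le b2.le (mul_right_cancel₀ (dir_ne_zero hb) hxd)
      field_simp at h1
      exact ij (by exact_mod_cast h1.symm)
    · exact ⟨x, h, hxd⟩
  obtain ⟨x, hx, hxd⟩ := hmem 1 one_pos (by omega) (Ne.symm e1)
  obtain ⟨y, hy, hyd⟩ := hmem (d - 1) (by omega) (by omega) (by omega)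
  have side := iff_of_isChain (p := fun z => ∃ t : ℝ, 0 < t ∧ t < 2 * Real.pi * j / d ∧
    D.dir v z = exp (t * I) * D.dir v b) hl (by
      intro z hz w hw hzw
      obtain ⟨i, i0, id, hi⟩ := exists_dir_eq_of_ne (D := D) hb (hl1 z hz).1 (hl1 z hz).2.1.symm
      obtain ⟨k, k0, kd, hk⟩ := exists_dir_eq_of_ne (D := D) hb (hl1 w hw).1 (hl1 w hw).2.1.symm
      obtain ⟨b1, b2⟩ := angle_mem_Ioo i0 id
      obtain ⟨c1, c2⟩ := angle_mem_Ioo k0 kd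
      have := hD.lt_iff_lt hb hc (hl1 z hz).1 (hl1 w hw).1 hbc hzw (hl1 z hz).2.1 (hl1 z hz).2.2
        (hl1 w hw).2.1 (hl1 w hw).2.2 b1 b2 c1 c2 a1 a2 hj hi hk
      constructor
      · rintro ⟨t, t0, t1, ht⟩
        rw [hi] at ht
        have h1 := angle_unique t0 (t1.trans a2) b1.le b2.le
          (mul_right_cancel₀ (dir_ne_zero hb) ht.symm)
        exact ⟨_, c1, this.mp (h1 ▸ t1), hk⟩
      · rintro ⟨t, t0, t1, ht⟩
        rw [hk] at ht
        have h1 := angle_unique t0 (t1.trans a2) c1.le c2.le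
          (mul_right_cancel₀ (dir_ne_zero hb) ht.symm)
        exact ⟨_, b1, this.mpr (h1 ▸ t1), hi⟩)
  have j2 : (1 : ℝ) < j := by exact_mod_cast (by omega : 1 < j)
  obtain ⟨t, t0, t1, ht⟩ := (side x hx y hy).mp ⟨2 * Real.pi * (1 : ℕ) / d, by positivity, by
    push_cast
    gcongr, hxd⟩
  obtain ⟨b1, b2⟩ := angle_mem_Ioo (j := d - 1) (d := d) (by omega) (by omega)
  rw [hyd] at ht
  have h1 := angle_unique t0 (t1.trans a2) b1.le b2.le
    (mul_right_cancel₀ (dir_ne_zero hb) ht.symm)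
  rw [h1] at t1
  have h2 : ((d - 1 : ℕ) : ℝ) < j := by
    rw [div_lt_div_iff_of_pos_right hd0] at t1
    nlinarith
  have h3 : d - 1 < j := by exact_mod_cast h2
  omega

/-! ### Incompatible angles -/

/-- A triangle cannot have a small angle at `p` and a large one at `q` (or conversely) on the same
side when the third angle is small or large as well: here an angle is small if it is one of
`ε`, `δ`, `η`, with `ε + δ + η ≤ π`, and large if the angle on the other side is small. -/
theorem IsPlanar.false_of_mixed_angles (hD : D.IsPlanar) {p q w : V} (hpq : G.Adj p q)
    (hqw : G.Adj q w) (hpw : G.Adj p w) {ε δ η : ℝ} (hε : 0 < ε) (hδ : 0 < δ) (hη : 0 < η)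
    (hsum : ε + δ + η ≤ Real.pi)
    (h : (D.dir p w = exp (ε * I) * D.dir p q ∧ D.dir q w = exp (δ * I) * D.dir q p) ∨
      (D.dir p q = exp (ε * I) * D.dir p w ∧ D.dir q p = exp (δ * I) * D.dir q w))
    (hw : D.dir w q = exp (η * I) * D.dir w p ∨ D.dir w p = exp (η * I) * D.dir w q) : False := by
  have hp := Real.pi_pos
  have flip : ∀ {u x y : V} {t : ℝ}, D.dir u x = exp (t * I) * D.dir u y →
      D.dir u y = exp (((2 * Real.pi - t : ℝ) : ℂ) * I) * D.dir u x := by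
    intro u x y t h
    rw [h, ← mul_assoc, ← Complex.exp_add]
    have : ((2 * Real.pi - t : ℝ) : ℂ) * I + t * I = 2 * Real.pi * I := by push_cast; ring
    rw [this, Complex.exp_two_pi_mul_I, one_mul]
  rcases h with ⟨h1, h2⟩ | ⟨h1, h2⟩ <;> rcases hw with hw | hw
  · have := (hD.triangle_angles hpw.symm hpq hqw.symm hη (by linarith) hε (by linarith)
      (by linarith) (by linarith) hw h1 (flip h2)).1
    linarith
  · have := (hD.triangle_angles hqw hpw.symm hpq.symm (by linarith) (by linarith) (by linarith)
      (by linarith) hε (by linarith) (flip h2) (flip hw) h1).2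
    linarith
  · have := (hD.triangle_angles hqw hpw.symm hpq.symm hδ (by linarith) hη
      (by linarith) (by linarith) (by linarith) h2 hw (flip h1)).1
    linarith
  · have := (hD.triangle_angles hpw.symm hpq hqw.symm (by linarith) (by linarith) (by linarith)
      (by linarith) hδ (by linarith) (flip hw) (flip h1) h2).2
    linarith

theorem rot_pow_mul {v x y : V} {k d : ℕ} (hd : (G.neighborSet v).ncard = d)
    (h : D.dir v y = rot G v ^ k * D.dir v x) :
    D.dir v y = exp (((2 * Real.pi * k / d : ℝ) : ℂ) * I) * D.dir v x := by
  rw [h, rot, hd, ← Complex.exp_nat_mul]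
  congr 2
  push_cast
  ring

theorem rot_ne_zero (v : V) : rot G v ≠ 0 := Complex.exp_ne_zero _

/-- Consecutive pairs `a, b` and `b, c` at `v` are traversed in the same sense of rotation. -/
theorem consecutive_trans {v a b c : V} (ha : G.Adj v a) (hc : G.Adj v c) (hac : a ≠ c)
    (h1 : D.dir v b = rot G v * D.dir v a ∨ D.dir v a = rot G v * D.dir v b)
    (h2 : D.dir v c = rot G v * D.dir v b ∨ D.dir v b = rot G v * D.dir v c) :
    (D.dir v b = rot G v * D.dir v a ∧ D.dir v c = rot G v * D.dir v b) ∨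
      (D.dir v a = rot G v * D.dir v b ∧ D.dir v b = rot G v * D.dir v c) := by
  have hne := dir_ne_dir (D := D) ha hc hac
  rcases h1 with h1 | h1 <;> rcases h2 with h2 | h2
  · exact Or.inl ⟨h1, h2⟩
  · exact absurd (mul_left_cancel₀ (rot_ne_zero v) (h1.symm.trans h2)) hne
  · exact absurd (h1.trans h2.symm) hne
  · exact Or.inr ⟨h1, h2⟩

/-- The same for three successive pairs `a, b`, `b, c` and `c, d`. -/
theorem consecutive_trans_four {v a b c d : V} (ha : G.Adj v a) (hb : G.Adj v b) (hc : G.Adj v c)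
    (hd : G.Adj v d) (hac : a ≠ c) (hbd : b ≠ d)
    (h1 : D.dir v b = rot G v * D.dir v a ∨ D.dir v a = rot G v * D.dir v b)
    (h2 : D.dir v c = rot G v * D.dir v b ∨ D.dir v b = rot G v * D.dir v c)
    (h3 : D.dir v d = rot G v * D.dir v c ∨ D.dir v c = rot G v * D.dir v d) :
    (D.dir v b = rot G v * D.dir v a ∧ D.dir v c = rot G v * D.dir v b ∧
        D.dir v d = rot G v * D.dir v c) ∨
      (D.dir v a = rot G v * D.dir v b ∧ D.dir v b = rot G v * D.dir v c ∧
        D.dir v c = rot G v * D.dir v d) := by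
  have hne := dir_ne_dir (D := D) ha hc hac
  rcases consecutive_trans hb hd hbd h2 h3 with ⟨e2, e3⟩ | ⟨e2, e3⟩ <;> rcases h1 with e1 | e1
  · exact Or.inl ⟨e1, e2, e3⟩
  · exact absurd (e1.trans e2.symm) hne
  · exact absurd (mul_left_cancel₀ (rot_ne_zero v) (e1.symm.trans e2)) hne
  · exact Or.inr ⟨e1, e2, e3⟩

end LombardiDrawing

/-! ### The planar 3-tree -/

/-- The graph obtained from `G` by stacking the vertices of a list one after the other, where each
of them is joined to `a`, to `b` and to the preceding one, the first one to `c`. -/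
def fan {V : Type*} (a b : V) : V → List V → SimpleGraph V → SimpleGraph V
  | _, [], G => G
  | c, v :: l, G =>
    fan a b v l (G ⊔ SimpleGraph.edge v a ⊔ SimpleGraph.edge v b ⊔ SimpleGraph.edge v c)

/-- Adjacency in a one-edge graph, decided by an instance that reduces in the kernel. -/
instance SimpleGraph.edge_decidableAdj {V : Type*} [DecidableEq V] (a b : V) :
    DecidableRel (SimpleGraph.edge a b).Adj :=
  fun _ _ => decidable_of_iff _ (SimpleGraph.edge_adj a b _ _).symm

instance fan.decidableAdj {V : Type*} [DecidableEq V] (a b : V) : ∀ (c : V) (l : List V)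
    (G : SimpleGraph V) [DecidableRel G.Adj], DecidableRel (fan a b c l G).Adj
  | _, [], _, h => h
  | _, v :: l, _, _ => fan.decidableAdj a b v l _

/-- Each stacking step leaves the triangle formed by `a`, `b` and the new vertex as the first face,
which is the face the next vertex of the fan goes into. -/
theorem ApollonianStep.exists_fan {V : Type*} [DecidableEq V] {a b : V} {l : List V} :
    ∀ {c : V} {S : Finset V} {G : SimpleGraph V} {F : Multiset (Finset V)},
    ApollonianStep S G ({a, b, c} ::ₘ F) → l.Nodup → (∀ v ∈ l, v ∉ S) →
      ∃ F', ApollonianStep (S ∪ l.toFinset) (fan a b c l G) (F' + F) := by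
  induction l with
  | nil =>
    intro c S G F h _ _
    exact ⟨{{a, b, c}}, by simpa [fan] using h⟩
  | cons v l ih =>
    intro c S G F h hn hS
    have hn' := List.nodup_cons.mp hn
    obtain ⟨F', hF⟩ := ih (ApollonianStep.stack S G F a b c v h (hS v (by simp))) hn'.2 (by
      intro w hw hwS
      rcases Finset.mem_insert.mp hwS with rfl | hwS
      · exact hn'.1 hw
      · exact hS w (by simp [hw]) hwS)
    refine ⟨F' + {{b, c, v}, {a, c, v}}, ?_⟩
    have e : S ∪ (v :: l).toFinset = insert v S ∪ l.toFinset := by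
      ext x; simp
    rw [e, fan]
    convert hF using 1
    simp [add_assoc]

/-- The planar 3-tree on the vertices `0, …, 23`: a complete graph on `0, 1, 2, 3`, a fan of
vertices `4, …, 15` joined to `0` and `3` in the face `0 1 3`, and a fan of vertices `16, …, 23`
joined to `1` and `2` in the face `1 2 3`. -/
def twoFans : SimpleGraph (Fin 24) :=
  fan 1 2 3 [16, 17, 18, 19, 20, 21, 22, 23]
    (fan 0 3 1 [4, 5, 6, 7, 8, 9, 10, 11, 12, 13, 14, 15]
      (fan 0 1 2 [3] (SimpleGraph.edge 0 1 ⊔ SimpleGraph.edge 1 2 ⊔ SimpleGraph.edge 0 2)))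

instance : DecidableRel twoFans.Adj :=
  @fan.decidableAdj _ _ _ _ _ _ _ (@fan.decidableAdj _ _ _ _ _ _ _ (fan.decidableAdj _ _ _ _ _))

theorem twoFans_isPlanarThreeTree : IsPlanarThreeTree twoFans := by
  have h0 := ApollonianStep.triangle (0 : Fin 24) 1 2 (by decide) (by decide) (by decide)
  have h1 := ApollonianStep.stack _ _ _ 0 1 2 3 h0 (by decide)
  rw [show ({0, 1, 3} : Finset (Fin 24)) = {0, 3, 1} by decide] at h1
  obtain ⟨F, h2⟩ := h1.exists_fan (l := [4, 5, 6, 7, 8, 9, 10, 11, 12, 13, 14, 15])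
    (by decide) (by decide)
  rw [Multiset.add_cons] at h2
  obtain ⟨F', h3⟩ := h2.exists_fan (l := [16, 17, 18, 19, 20, 21, 22, 23]) (by decide) (by decide)
  change ApollonianStep _ twoFans _ at h3
  refine ⟨F' + (F + ({0, 2, 3} ::ₘ {0, 1, 2} ::ₘ 0)), ?_⟩
  convert h3 using 1
  decide

theorem ncard_neighborSet_twoFans (v : Fin 24) :
    (twoFans.neighborSet v).ncard = twoFans.degree v := by
  rw [Set.ncard_eq_toFinset_card', ← SimpleGraph.neighborFinset_def, SimpleGraph.degree]

theorem LombardiDrawing.not_isPlanar_twoFans (D : LombardiDrawing twoFans) : ¬ D.IsPlanar := by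
  intro hD
  have d0 : (twoFans.neighborSet 0).ncard = 15 := by
    rw [ncard_neighborSet_twoFans]; decide
  have d1 : (twoFans.neighborSet 1).ncard = 12 := by
    rw [ncard_neighborSet_twoFans]; decide
  have d2 : (twoFans.neighborSet 2).ncard = 11 := by
    rw [ncard_neighborSet_twoFans]; decide
  have d3 : (twoFans.neighborSet 3).ncard = 16 := by
    rw [ncard_neighborSet_twoFans]; decide
  -- at `0`, the edges to `1, 2, 3` are consecutive
  have c0 := consecutive_trans (D := D) (v := 0) (a := 1) (b := 2) (c := 3)
    (by decide) (by decide) (by decide)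
    (hD.consecutive (by decide) (by decide) (by decide)
      [4, 5, 6, 7, 8, 9, 10, 11, 12, 13, 14, 15, 3] (by decide) (by decide) (by decide))
    (hD.consecutive (by decide) (by decide) (by decide)
      [1, 4, 5, 6, 7, 8, 9, 10, 11, 12, 13, 14, 15] (by decide) (by decide) (by decide))
  -- at `1`, the edges to `2, 0, 4, 3` are consecutive
  have c1 := consecutive_trans_four (D := D) (v := 1) (a := 2) (b := 0) (c := 4) (d := 3)
    (by decide) (by decide) (by decide) (by decide) (by decide) (by decide)
    (hD.consecutive (by decide) (by decide) (by decide)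
      [4, 3, 16, 17, 18, 19, 20, 21, 22, 23] (by decide) (by decide) (by decide))
    (hD.consecutive (by decide) (by decide) (by decide)
      [3, 16, 17, 18, 19, 20, 21, 22, 23, 2] (by decide) (by decide) (by decide))
    (hD.consecutive (by decide) (by decide) (by decide)
      [16, 17, 18, 19, 20, 21, 22, 23, 2, 0] (by decide) (by decide) (by decide))
  -- at `2`, the edges to `0, 1` are consecutive
  have c2 := hD.consecutive (v := 2) (b := 0) (c := 1) (by decide) (by decide) (by decide)
    [3, 16, 17, 18, 19, 20, 21, 22, 23] (by decide) (by decide) (by decide)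
  -- at `3`, the edges to `0, 2, 16, 1` are consecutive
  have c3 := consecutive_trans_four (D := D) (v := 3) (a := 0) (b := 2) (c := 16) (d := 1)
    (by decide) (by decide) (by decide) (by decide) (by decide) (by decide)
    (hD.consecutive (by decide) (by decide) (by decide)
      [16, 1, 4, 5, 6, 7, 8, 9, 10, 11, 12, 13, 14, 15] (by decide) (by decide) (by decide))
    (hD.consecutive (by decide) (by decide) (by decide)
      [1, 4, 5, 6, 7, 8, 9, 10, 11, 12, 13, 14, 15, 0] (by decide) (by decide) (by decide))
    (hD.consecutive (by decide) (by decide) (by decide)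
      [4, 5, 6, 7, 8, 9, 10, 11, 12, 13, 14, 15, 0, 2] (by decide) (by decide) (by decide))
  have hp := Real.pi_pos
  have one : ∀ {v x y : Fin 24} {d : ℕ}, (twoFans.neighborSet v).ncard = d →
      D.dir v y = rot twoFans v * D.dir v x →
      D.dir v y = exp (((2 * Real.pi * (1 : ℕ) / d : ℝ) : ℂ) * I) * D.dir v x :=
    fun hd h => rot_pow_mul hd (by rw [pow_one, h])
  have two : ∀ {v x y z : Fin 24} {d : ℕ}, (twoFans.neighborSet v).ncard = d →
      D.dir v y = rot twoFans v * D.dir v x → D.dir v z = rot twoFans v * D.dir v y →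
      D.dir v z = exp (((2 * Real.pi * (2 : ℕ) / d : ℝ) : ℂ) * I) * D.dir v x :=
    fun hd h h' => rot_pow_mul hd (by rw [h', h]; ring)
  have w2 := c2.imp (one d2) (one d2)
  have w3 : D.dir 3 1 = exp (((2 * Real.pi * (3 : ℕ) / (16 : ℕ) : ℝ) : ℂ) * I) * D.dir 3 0 ∨
      D.dir 3 0 = exp (((2 * Real.pi * (3 : ℕ) / (16 : ℕ) : ℝ) : ℂ) * I) * D.dir 3 1 :=
    c3.imp (fun ⟨e1, e2, e3⟩ => rot_pow_mul d3 (by rw [e3, e2, e1]; ring))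
      (fun ⟨e1, e2, e3⟩ => rot_pow_mul d3 (by rw [e1, e2, e3]; ring))
  -- `0 1 2` excludes that its angles at `0` and `1` on one side are a small and a large one
  have t1 := hD.false_of_mixed_angles (p := 0) (q := 1) (w := 2) (by decide) (by decide)
    (by decide) (ε := 2 * Real.pi * (1 : ℕ) / (15 : ℕ)) (δ := 2 * Real.pi * (1 : ℕ) / (12 : ℕ))
    (η := 2 * Real.pi * (1 : ℕ) / (11 : ℕ)) (by positivity) (by positivity) (by positivity)
    (by push_cast; linarith)
  -- `0 1 3` excludes the same for its own angles; relative to `0 1 2`, small and large are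
  -- interchanged at `1` but not at `0`
  have t2 := hD.false_of_mixed_angles (p := 0) (q := 1) (w := 3) (by decide) (by decide)
    (by decide) (ε := 2 * Real.pi * (2 : ℕ) / (15 : ℕ)) (δ := 2 * Real.pi * (2 : ℕ) / (12 : ℕ))
    (η := 2 * Real.pi * (3 : ℕ) / (16 : ℕ)) (by positivity) (by positivity) (by positivity)
    (by push_cast; linarith)
  rcases c0 with ⟨a1, a2⟩ | ⟨a1, a2⟩ <;> rcases c1 with ⟨b1, b2, b3⟩ | ⟨b1, b2, b3⟩
  · exact t2 (Or.inl ⟨two d0 a1 a2, two d1 b2 b3⟩) w3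
  · exact t1 (Or.inl ⟨one d0 a1, one d1 b1⟩) w2
  · exact t1 (Or.inr ⟨one d0 a1, one d1 b1⟩) w2
  · exact t2 (Or.inr ⟨two d0 a2 a1, two d1 b3 b2⟩) w3

theorem mainTheorem6 :
    ∃ (n : ℕ) (G : SimpleGraph (Fin n)),
      IsPlanarThreeTree G ∧ ¬ ∃ D : LombardiDrawing G, D.IsPlanar :=
  ⟨24, twoFans, twoFans_isPlanarThreeTree, fun ⟨D, hD⟩ => D.not_isPlanar_twoFans hD⟩
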